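/- Let $J$ and $R$ be anticommuting fundamental symmetries in a complex Hilbert space $\mathfrak H$ (bounded operators with $J=J^*$, $J^2=I$, $R=R^*$, $R^2=I$, $JR=-RJ$). Let $S$ be a closed densely defined symmetric operator in $\mathfrak H$ with defect numbers $\langle 2,2\rangle$ (that is, $\dim\ker(S^*\mp iI)=2$) which is simple (no nonzero closed subspace reduces $S$ to a self-adjoint operator) and satisfies $SJ=JS$ and $SR=RS$. An operator $A$ has the $C$-symmetry, where $C$ is a bounded operator, if $C^2=I$, $JC>0$ and $AC=CA$. Let $\{C_\alpha\}$ be the set of all $C$ for which $S$ has the $C$-symmetry. Let $\Sigma_J$ be the set of operators $A\supset S$ with $A^*J=JA$; let $\Sigma_J^{\mathsf{st}}$ be the set of $A\in\Sigma_J$ which have the $C$-symmetry for some $C\in\{C_\alpha\}$; and let $\Upsilon$ be the set of $A\in\Sigma_J$ with $AC=CA$ for all $C\in\{C_\alpha\}$. Assume that $\Upsilon\neq\emptyset$. For $\chi,\omega\in\mathbb R$ put $$R_\omega=Re^{i\omega J}=R(\cos\omega\, I+i\sin\omega\, J),\qquad C_{\chi,\omega}=Je^{\chi R_\omega}=J(\cosh\chi\,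 I+\sinh\chi\, R_\omega).$$ Let $(\mathcal H,\Gamma_0,\Gamma_1)$ be a boundary triplet for $S^*$, i.e. $\mathcal H$ is a Hilbert space and $\Gamma_0,\Gamma_1:\mathcal D(S^*)\to\mathcal H$ are linear maps such that $(\Gamma_0,\Gamma_1)$ maps $\mathcal D(S^*)$ onto $\mathcal H\oplus\mathcal H$ and $(S^*x,y)-(x,S^*y)=(\Gamma_1x,\Gamma_0y)-(\Gamma_0x,\Gamma_1y)$ for all $x,y\in\mathcal D(S^*)$. Assume that there are bounded operators $\mathcal J,\mathcal R$ in $\mathcal H$ with $\mathcal J\Gamma_jf=\Gamma_jJf$ and $\mathcal R\Gamma_jf=\Gamma_jRf$ for $f\in\mathcal D(S^*)$, $j=0,1$. Fix an orthonormal basis of $\mathcal H$ (which is two-dimensional) in which $\mathcal J$ and $\mathcal R$ have the matrices $\begin{pmatrix}1&0\\0&-1\end{pmatrix}$ and $\begin{pmatrix}0&1\\1&0\end{pmatrix}$, and identify operators in $\mathcal H$ with their matrices in this basis. Put $\Omega_\pm=\frac1{\sqrt2}(\Gamma_1\pm i\Gamma_0)$ and, for a linear operator $\mathcal K$ in $\mathcal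 H$, $$A_{\mathcal K}=S^*\upharpoonright\{f\in\mathcal D(S^*) : \mathcal K\Omega_+f=\Omega_-f\}.$$ Call $\mathcal K$ $\mathcal J$-unitary if it is onto and $(\mathcal J\mathcal Kx,\mathcal Ky)=(\mathcal Jx,y)$ for all $x,y\in\mathcal H$. Then $A_{\mathcal K}\in\Sigma_J$ if and only if $\mathcal K$ is $\mathcal J$-unitary, and this holds if and only if $$\mathcal K=\mathcal K(\zeta,\phi,\xi,\omega)=e^{-i\xi}\begin{pmatrix}-e^{-i\phi}\cosh\zeta & e^{-i\omega}\sinh\zeta\\ -e^{i\omega}\sinh\zeta & e^{i\phi}\cosh\zeta\end{pmatrix}$$ for some $\zeta\in\mathbb R$, $\phi\in[0,\pi]$ and $\xi,\omega\in[0,2\pi)$. Moreover, for all such $\zeta,\phi,\xi,\omega$ and $\mathcal K=\mathcal K(\zeta,\phi,\xi,\omega)$: (i) the adjoint $A_{\mathcal K}^*$ belongs to $\Sigma_J$ and equals $A_{\mathcal K'}$ with $\mathcal K'=\mathcal K(-\zeta,\phi,\xi,\omega)$; (ii) $A_{\mathcal K}$ is self-adjoint if and only if $\zeta=0$, i.e.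 $\mathcal K=\mathcal K(0,\phi,\xi,\omega)=e^{-i\xi}\begin{pmatrix}-e^{-i\phi}&0\\0&e^{i\phi}\end{pmatrix}$; (iii) $A_{\mathcal K}\in\Sigma_J^{\mathsf{st}}\setminus\Upsilon$ if and only if $|\tanh\zeta|<|\cos\phi|$; (iv) $A_{\mathcal K}\in\Upsilon$ if and only if $\zeta=0$ and $\phi=\pi/2$, i.e. $\mathcal K=\mathcal K(0,\pi/2,\xi,\omega)=ie^{-i\xi}I$. Furthermore, if $|\tanh\zeta|<|\cos\phi|$, then the equation $\cos\phi\,\tanh\chi=-\tanh\zeta$ has a unique solution $\chi\in\mathbb R$, and for this $\chi$ the operator $A_{\mathcal K}$ has the $C_{\chi,\omega}$-symmetry. -/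

import Mathlib

open Complex

noncomputable section

namespace KreinExt

variable {H : Type*} [NormedAddCommGroup H] [InnerProductSpace ℂ H]
variable {G : Type*} [NormedAddCommGroup G] [InnerProductSpace ℂ G]

/-- A fundamental symmetry: a bounded operator with `J = J*` and `J² = I`. -/
def IsFundamentalSymmetry [CompleteSpace H] (J : H →L[ℂ] H) : Prop :=
  IsSelfAdjoint J ∧ J ∘L J = ContinuousLinearMap.id ℂ H

/-- The product `A C` of an (unbounded) operator `A` with a bounded operator `C`, with its natural
domain `{x | C x ∈ D(A)}`. -/
def mulBounded (A : H →ₗ.[ℂ] H) (C : H →L[ℂ] H) : H →ₗ.[ℂ] H where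
  domain := A.domain.comap (C : H →ₗ[ℂ] H)
  toFun := A.toFun ∘ₗ (C : H →ₗ[ℂ] H).restrict (fun _ hx => hx)

/-- The product `C A` of a bounded operator `C` with an (unbounded) operator `A`; its domain is
`D(A)`. -/
def boundedMul (C : H →L[ℂ] H) (A : H →ₗ.[ℂ] H) : H →ₗ.[ℂ] H :=
  (C : H →ₗ[ℂ] H).compPMap A

/-- `[A, C] = 0`, i.e. `A C = C A` including equality of domains. -/
def Commutes (A : H →ₗ.[ℂ] H) (C : H →L[ℂ] H) : Prop :=
  mulBounded A C = boundedMul C A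

/-- Strict positivity `T > 0` of a bounded operator. -/
def StrictlyPos [CompleteSpace H] (T : H →L[ℂ] H) : Prop :=
  IsSelfAdjoint T ∧ ∀ x : H, x ≠ 0 → 0 < (inner ℂ (T x) x).re

/-- The operator `A` has the `C`-symmetry in the Krein space with fundamental symmetry `J`:
`C² = I`, `J C > 0` and `A C = C A`. -/
def HasCSymmetry [CompleteSpace H] (J : H →L[ℂ] H) (A : H →ₗ.[ℂ] H) (C : H →L[ℂ] H) : Prop :=
  C ∘L C = ContinuousLinearMap.id ℂ H ∧ StrictlyPos (J ∘L C) ∧ Commutes A C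

/-- The collection `{C_α}` of all operators which realize the property of `C`-symmetry
for `S`. -/
def cSymmetries [CompleteSpace H] (J : H →L[ℂ] H) (S : H →ₗ.[ℂ] H) : Set (H →L[ℂ] H) :=
  {C | HasCSymmetry J S C}

/-- `A` is `J`-self-adjoint: `A* J = J A`. -/
def IsJSelfAdjoint [CompleteSpace H] (J : H →L[ℂ] H) (A : H →ₗ.[ℂ] H) : Prop :=
  mulBounded A.adjoint J = boundedMul J A

/-- `Σ_J`: the `J`-self-adjoint extensions of `S`. -/
def sigmaJ [CompleteSpace H] (J : H →L[ℂ] H) (S : H →ₗ.[ℂ] H) : Set (H →ₗ.[ℂ] H) :=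
  {A | S ≤ A ∧ IsJSelfAdjoint J A}

/-- `Σ_J^st`: the `J`-self-adjoint extensions of `S` with stable `C`-symmetry. -/
def sigmaJst [CompleteSpace H] (J : H →L[ℂ] H) (S : H →ₗ.[ℂ] H) : Set (H →ₗ.[ℂ] H) :=
  {A | A ∈ sigmaJ J S ∧ ∃ C ∈ cSymmetries J S, HasCSymmetry J A C}

/-- `Υ`: the `J`-self-adjoint extensions of `S` commuting with every `C`-symmetry of `S`. -/
def upsilon [CompleteSpace H] (J : H →L[ℂ] H) (S : H →ₗ.[ℂ] H) : Set (H →ₗ.[ℂ] H) :=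
  {A | A ∈ sigmaJ J S ∧ ∀ C ∈ cSymmetries J S, Commutes A C}

/-- The closed densely defined symmetric operators. -/
def IsClosedSymmetric (S : H →ₗ.[ℂ] H) : Prop :=
  Dense (S.domain : Set H) ∧ S.IsClosed ∧ S.IsFormalAdjoint S

/-- The defect subspace `ker (S* - μ I)`. -/
def defectSubspace [CompleteSpace H] (S : H →ₗ.[ℂ] H) (μ : ℂ) : Submodule ℂ H :=
  S.adjoint.graph.comap (LinearMap.prod LinearMap.id (μ • LinearMap.id))

/-- The symmetric operator `S` has defect numbers `<2,2>`. -/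
def HasDefectTwoTwo [CompleteSpace H] (S : H →ₗ.[ℂ] H) : Prop :=
  Module.finrank ℂ (defectSubspace S I) = 2 ∧ Module.finrank ℂ (defectSubspace S (-I)) = 2

/-- The closed subspace `M`, with orthogonal projection `P`, reduces `S`: `P D(S) ⊆ D(S)` and
`S P x = P S x` for `x ∈ D(S)`. -/
def Reduces (S : H →ₗ.[ℂ] H) (M : Submodule ℂ H) [M.HasOrthogonalProjection] : Prop :=
  ∀ x : S.domain, ∃ h : M.starProjection (x : H) ∈ S.domain,
    S ⟨M.starProjection (x : H), h⟩ = M.starProjection (S x)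

/-- The part of `S` in `M`, with domain `D(S) ∩ M`. (The projection is only there to have values
in `M`; if `M` reduces `S`, then `S x ∈ M` for `x ∈ D(S) ∩ M`.) -/
def part (S : H →ₗ.[ℂ] H) (M : Submodule ℂ H) [M.HasOrthogonalProjection] : M →ₗ.[ℂ] M where
  domain := S.domain.comap M.subtype
  toFun := (M.orthogonalProjectionOnto : H →ₗ[ℂ] M) ∘ₗ S.toFun ∘ₗ
    M.subtype.restrict (fun _ hx => hx)

/-- `S` is simple: there is no nonzero closed subspace which reduces `S` to a self-adjoint
operator. -/
def IsSimple (S : H →ₗ.[ℂ] H) : Prop :=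
  ∀ (M : Submodule ℂ H) [CompleteSpace M], Reduces S M → IsSelfAdjoint (part S M) → M = ⊥

/-- `(G, Γ₀, Γ₁)` is a boundary triplet for `S*`: the abstract Green identity
`(S*x, y) - (x, S*y) = (Γ₁x, Γ₀y) - (Γ₀x, Γ₁y)` holds and `(Γ₀, Γ₁)` is onto `G ⊕ G`.
(Mathlib's inner product is linear in the second argument.) -/
def IsBoundaryTriplet [CompleteSpace H] (S : H →ₗ.[ℂ] H)
    (Γ₀ Γ₁ : S.adjoint.domain →ₗ[ℂ] G) : Prop :=
  (∀ x y : S.adjoint.domain,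
    inner ℂ (y : H) (S.adjoint x) - inner ℂ (S.adjoint y) (x : H) =
      inner ℂ (Γ₀ y) (Γ₁ x) - inner ℂ (Γ₁ y) (Γ₀ x)) ∧
  Function.Surjective (Γ₀.prod Γ₁)

/-- The formulas `T' Γ_j = Γ_j T` on `D(S*)`, for a boundary map `Γ` and an operator `T` leaving
`D(S*)` invariant. -/
def Intertwines [CompleteSpace H] {S : H →ₗ.[ℂ] H} (Γ : S.adjoint.domain →ₗ[ℂ] G)
    (T : H →L[ℂ] H) (T' : G →L[ℂ] G) : Prop :=
  ∀ f : S.adjoint.domain, ∃ h : T (f : H) ∈ S.adjoint.domain, T' (Γ f) = Γ ⟨T (f : H), h⟩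

/-- `Ω₊ = (Γ₁ + i Γ₀) / √2`. -/
def omegaPlus {D : Type*} [AddCommGroup D] [Module ℂ D] (Γ₀ Γ₁ : D →ₗ[ℂ] G) : D →ₗ[ℂ] G :=
  ((1 / Real.sqrt 2 : ℝ) : ℂ) • (Γ₁ + I • Γ₀)

/-- `Ω₋ = (Γ₁ - i Γ₀) / √2`. -/
def omegaMinus {D : Type*} [AddCommGroup D] [Module ℂ D] (Γ₀ Γ₁ : D →ₗ[ℂ] G) : D →ₗ[ℂ] G :=
  ((1 / Real.sqrt 2 : ℝ) : ℂ) • (Γ₁ - I • Γ₀)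

/-- The extension `A_K`, the restriction of `S*` to `{f ∈ D(S*) | K Ω₊ f = Ω₋ f}`. -/
def extensionOf [CompleteSpace H] (S : H →ₗ.[ℂ] H) (Γ₀ Γ₁ : S.adjoint.domain →ₗ[ℂ] G)
    (K : G →ₗ[ℂ] G) : H →ₗ.[ℂ] H :=
  S.adjoint.domRestrict
    ((LinearMap.eqLocus (K ∘ₗ omegaPlus Γ₀ Γ₁) (omegaMinus Γ₀ Γ₁)).map S.adjoint.domain.subtype)

/-- `K` is a unitary operator of the Krein space with fundamental symmetry `J`: it is onto and
preserves the indefinite inner product `[x, y]_J = (J x, y)`. -/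
def IsJUnitary (J : G →L[ℂ] G) (K : G →ₗ[ℂ] G) : Prop :=
  Function.Surjective K ∧ ∀ x y : G, inner ℂ (K y) (J (K x)) = inner ℂ y (J x)

/-- `R_ω = R e^{iωJ} = R (cos ω I + i sin ω J)`. -/
def rOmega (J R : H →L[ℂ] H) (ω : ℝ) : H →L[ℂ] H :=
  R ∘L ((Real.cos ω : ℂ) • ContinuousLinearMap.id ℂ H + (I * (Real.sin ω : ℂ)) • J)

/-- `C_{χ,ω} = J e^{χ R_ω} = J (cosh χ I + sinh χ R_ω)`. -/
def cChiOmega (J R : H →L[ℂ] H) (χ ω : ℝ) : H →L[ℂ] H :=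
  J ∘L ((Real.cosh χ : ℂ) • ContinuousLinearMap.id ℂ H + (Real.sinh χ : ℂ) • rOmega J R ω)

/-- The matrix `K(ζ, φ, ξ, ω)`. -/
def kMatrix (ζ φ ξ ω : ℝ) : Matrix (Fin 2) (Fin 2) ℂ :=
  exp (-(I * ξ)) •
    !![-exp (-(I * φ)) * (Real.cosh ζ : ℂ), exp (-(I * ω)) * (Real.sinh ζ : ℂ);
       -exp (I * ω) * (Real.sinh ζ : ℂ), exp (I * φ) * (Real.cosh ζ : ℂ)]

/-- The operator on the boundary space which has the matrix `M` in the orthonormal basis `b`. -/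
def ofMatrix (b : OrthonormalBasis (Fin 2) ℂ G) (M : Matrix (Fin 2) (Fin 2) ℂ) : G →ₗ[ℂ] G :=
  Matrix.toLin b.toBasis b.toBasis M

end KreinExt

end

open KreinExt

/-! An operator between `S` and `S*` is a condition on boundary values, so each assertion reduces to
one about 2×2 matrices. In terms of Ω₊ and Ω₋ the Green form is a difference of two definite forms
(`inner_omega_sub_inner_omega`). Hence the adjoint of A_K is given by Ω₊f = K*Ω₋f, and
J-self-adjointness says exactly that K is J-unitary. Moduli and phases of the entries of such a K
give ζ, φ, ξ, ω (`IsJUnitaryMatrix.exists_eq_kMatrix`), and (K*)⁻¹ = JKJ gives the adjoint.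

If C acts on boundary values through an operator C₀, then A_K commutes with C iff K commutes with C₀
(`graphInvariant_extensionOf_iff`). For C_{χ,ω} such a C₀ is given by the same formula. For an
arbitrary C-symmetry of `S` its existence is the crux, and here Υ ≠ ∅ enters
(`exists_boundary_cSymmetry_of_upsilon`). A member A of Υ commutes with J and R, so it is
self-adjoint with a condition aΓ₁ = cΓ₀, where a and c are real. A real symplectic change of triplet
turns D(A) into ker Γ₀, so C preserves ker Γ₀ and induces C₀ through the γ-field at i. By a Schur
argument for the pair 𝒥, ℛ, the γ-field is isometric up to a factor and the Weyl function at i is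
scalar. Hence C₀ inherits the properties of C and intertwines Γ₁ as well
(`exists_boundary_cSymmetry`).

An involution C₀ with 𝒥C₀ > 0 has rows (a, z) and (-z̄, -a), with a > 0 and a² = 1 + |z|². Commuting
with K forces |cos φ| cosh ζ |z| = a |sinh ζ|. Since |z| < a, either |tanh ζ| < |cos φ| or K is
scalar. Conversely, if cos φ tanh χ = -tanh ζ, the matrix of C_{χ,ω} commutes with K. -/

noncomputable section

namespace KreinExt

section


variable {H : Type*} [NormedAddCommGroup H] [InnerProductSpace ℂ H]
variable {G : Type*} [NormedAddCommGroup G] [InnerProductSpace ℂ G]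

/-! ### Graphs of unbounded operators -/

/-- The graph of `A` is invariant under `C ⊕ C`, i.e. `C A ⊆ A C`. -/
def GraphInvariant (A : H →ₗ.[ℂ] H) (C : H →L[ℂ] H) : Prop :=
  ∀ x y, (x, y) ∈ A.graph → (C x, C y) ∈ A.graph

theorem mem_graph_mulBounded {A : H →ₗ.[ℂ] H} {C : H →L[ℂ] H} {x z : H} :
    (x, z) ∈ (mulBounded A C).graph ↔ (C x, z) ∈ A.graph := by
  simp only [LinearPMap.mem_graph_iff]
  constructor
  · rintro ⟨⟨w, hw⟩, rfl, rfl⟩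
    exact ⟨⟨C w, hw⟩, rfl, rfl⟩
  · rintro ⟨⟨w, hw⟩, h, rfl⟩
    dsimp only at h
    subst h
    exact ⟨⟨x, hw⟩, rfl, rfl⟩

theorem mem_graph_boundedMul {A : H →ₗ.[ℂ] H} {C : H →L[ℂ] H} {x z : H} :
    (x, z) ∈ (boundedMul C A).graph ↔ ∃ y, (x, y) ∈ A.graph ∧ C y = z := by
  simp only [LinearPMap.mem_graph_iff]
  constructor
  · rintro ⟨w, rfl, rfl⟩
    exact ⟨_, ⟨w, rfl, rfl⟩, rfl⟩
  · rintro ⟨y, ⟨w, rfl, rfl⟩, rfl⟩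
    exact ⟨w, rfl, rfl⟩

theorem eq_iff_graph {A B : H →ₗ.[ℂ] H} :
    A = B ↔ ∀ x y, (x, y) ∈ A.graph ↔ (x, y) ∈ B.graph := by
  constructor
  · rintro rfl x y
    rfl
  · intro h
    apply LinearPMap.eq_of_eq_graph
    ext ⟨x, y⟩
    exact h x y

theorem le_iff_graph {A B : H →ₗ.[ℂ] H} :
    A ≤ B ↔ ∀ x y, (x, y) ∈ A.graph → (x, y) ∈ B.graph := by
  constructor
  · intro h x y hxy
    exact LinearPMap.le_graph_of_le h hxy
  · intro h
    apply LinearPMap.le_of_le_graph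
    rintro ⟨x, y⟩ hxy
    exact h x y hxy

theorem apply_apply_of_comp_self {C : H →L[ℂ] H} (hC : C ∘L C = ContinuousLinearMap.id ℂ H)
    (x : H) : C (C x) = x :=
  congrArg (fun T : H →L[ℂ] H => T x) hC

/-- For an involution the inclusion CA ⊆ AC already gives equality: applying it to (Cx, z) and
cancelling C² returns the other inclusion. -/
theorem commutes_iff_graphInvariant {A : H →ₗ.[ℂ] H} {C : H →L[ℂ] H}
    (hC : C ∘L C = ContinuousLinearMap.id ℂ H) : Commutes A C ↔ GraphInvariant A C := by
  have hCC := apply_apply_of_comp_self hC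
  simp only [Commutes, eq_iff_graph, mem_graph_mulBounded, mem_graph_boundedMul, GraphInvariant]
  constructor
  · intro h x y hxy
    exact (h x (C y)).2 ⟨y, hxy, rfl⟩
  · intro h x z
    constructor
    · intro hz
      refine ⟨C z, ?_, hCC z⟩
      simpa [hCC] using h _ _ hz
    · rintro ⟨y, hy, rfl⟩
      exact h _ _ hy

theorem GraphInvariant.id (A : H →ₗ.[ℂ] H) :
    GraphInvariant A (ContinuousLinearMap.id ℂ H) := fun _ _ h => h

theorem GraphInvariant.comp {A : H →ₗ.[ℂ] H} {C C' : H →L[ℂ] H} (h : GraphInvariant A C)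
    (h' : GraphInvariant A C') : GraphInvariant A (C ∘L C') :=
  fun _ _ hxy => h _ _ (h' _ _ hxy)

theorem GraphInvariant.add {A : H →ₗ.[ℂ] H} {C C' : H →L[ℂ] H} (h : GraphInvariant A C)
    (h' : GraphInvariant A C') : GraphInvariant A (C + C') :=
  fun _ _ hxy => A.graph.add_mem (h _ _ hxy) (h' _ _ hxy)

theorem GraphInvariant.smul {A : H →ₗ.[ℂ] H} {C : H →L[ℂ] H} (c : ℂ) (h : GraphInvariant A C) :
    GraphInvariant A (c • C) :=
  fun _ _ hxy => A.graph.smul_mem c (h _ _ hxy)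

variable [CompleteSpace H]

/-! ### Adjoints and J-self-adjointness through graphs -/

theorem mem_graph_adjoint {A : H →ₗ.[ℂ] H} (hA : Dense (A.domain : Set H)) {x y : H} :
    (x, y) ∈ A.adjoint.graph ↔ ∀ a c, (a, c) ∈ A.graph → inner ℂ c x = inner ℂ a y := by
  rw [LinearPMap.adjoint_graph_eq_graph_adjoint hA, Submodule.mem_adjoint_iff]
  simp only [sub_eq_zero]

theorem GraphInvariant.adjoint {A : H →ₗ.[ℂ] H} (hA : Dense (A.domain : Set H))
    {C C' : H →L[ℂ] H} (hCC' : ∀ x y, inner ℂ (C x) y = inner ℂ x (C' y))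
    (h : GraphInvariant A C) : GraphInvariant A.adjoint C' := by
  intro x y hxy
  rw [mem_graph_adjoint hA] at hxy ⊢
  intro a c hac
  rw [← hCC', ← hCC', hxy _ _ (h _ _ hac)]

/-- A closed operator contains its bi-adjoint. -/
theorem mem_graph_of_forall_adjoint {A : H →ₗ.[ℂ] H} (hA : Dense (A.domain : Set H))
    (hc : A.IsClosed) {x y : H}
    (h : ∀ a c, (a, c) ∈ A.adjoint.graph → inner ℂ c x = inner ℂ a y) : (x, y) ∈ A.graph := by
  let e := (WithLp.prodContinuousLinearEquiv 2 ℂ H H)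
  let U : Submodule ℂ (WithLp 2 (H × H)) := A.graph.comap (e : WithLp 2 (H × H) →ₗ[ℂ] H × H)
  have hU : IsClosed (U : Set (WithLp 2 (H × H))) := hc.preimage e.continuous
  have key : WithLp.toLp 2 (x, y) ∈ Uᗮᗮ := by
    rw [Submodule.mem_orthogonal]
    intro u hu
    rw [Submodule.mem_orthogonal] at hu
    -- The orthogonal complement of the graph of A is the graph of the adjoint, rotated by a quarter
    -- turn.
    have h1 : (u.snd, -u.fst) ∈ A.adjoint.graph := by
      rw [mem_graph_adjoint hA]
      intro a c hac
      have := hu (WithLp.toLp 2 (a, c)) hac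
      rw [WithLp.prod_inner_apply] at this
      change inner ℂ a u.fst + inner ℂ c u.snd = 0 at this
      rw [inner_neg_right]
      linear_combination this
    have := h _ _ h1
    rw [WithLp.prod_inner_apply]
    change inner ℂ u.fst x + inner ℂ u.snd y = 0
    rw [inner_neg_left] at this
    linear_combination -this
  have hUc : CompleteSpace U := hU.completeSpace_coe
  rw [Submodule.orthogonal_orthogonal] at key
  exact key

theorem isJSelfAdjoint_iff {J : H →L[ℂ] H} (hJ : J ∘L J = ContinuousLinearMap.id ℂ H)
    {A : H →ₗ.[ℂ] H} :
    IsJSelfAdjoint J A ↔ ∀ x y, (J x, J y) ∈ A.adjoint.graph ↔ (x, y) ∈ A.graph := by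
  have hJJ := apply_apply_of_comp_self hJ
  simp only [IsJSelfAdjoint, eq_iff_graph, mem_graph_mulBounded, mem_graph_boundedMul]
  constructor
  · intro h x y
    rw [h]
    constructor
    · rintro ⟨z, hz, hzy⟩
      rwa [← hJJ y, ← hzy, hJJ]
    · intro h
      exact ⟨y, h, rfl⟩
  · intro h x z
    constructor
    · intro hz
      exact ⟨J z, (h _ _).1 (by rwa [hJJ]), hJJ z⟩
    · rintro ⟨y, hy, rfl⟩
      exact (h _ _).2 hy

theorem IsFundamentalSymmetry.inner_left {J : H →L[ℂ] H} (hJ : IsFundamentalSymmetry J)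
    (x y : H) : inner ℂ (J x) y = inner ℂ x (J y) := by
  rw [← ContinuousLinearMap.adjoint_inner_right, ← ContinuousLinearMap.star_eq_adjoint,
    hJ.1.star_eq]

end

section


variable {H : Type*} [NormedAddCommGroup H] [InnerProductSpace ℂ H] [CompleteSpace H]
variable {G : Type*} [NormedAddCommGroup G] [InnerProductSpace ℂ G]
variable {S A : H →ₗ.[ℂ] H} {Γ₀ Γ₁ : S.adjoint.domain →ₗ[ℂ] G}

/-! ### Boundary triplets -/

theorem mem_graph_adjoint_self (f : S.adjoint.domain) :
    ((f : H), S.adjoint f) ∈ S.adjoint.graph :=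
  S.adjoint.mem_graph f

theorem IsClosedSymmetric.le_adjoint (hS : IsClosedSymmetric S) : S ≤ S.adjoint :=
  LinearPMap.IsFormalAdjoint.le_adjoint hS.1 hS.2.2

theorem exists_eq_of_surjective_prod {D : Type*} [AddCommGroup D] [Module ℂ D]
    {Γ₀ Γ₁ : D →ₗ[ℂ] G} (h : Function.Surjective (Γ₀.prod Γ₁)) (u v : G) :
    ∃ f : D, Γ₀ f = u ∧ Γ₁ f = v := by
  obtain ⟨f, hf⟩ := h (u, v)
  exact ⟨f, congrArg Prod.fst hf, congrArg Prod.snd hf⟩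

/-- Since `S` is closed, it equals S**, so membership means that the Green form against all of D(S*)
vanishes. Surjectivity of the boundary maps turns this into vanishing boundary values. -/
theorem IsBoundaryTriplet.mem_graph_iff (hS : IsClosedSymmetric S)
    (hΓ : IsBoundaryTriplet S Γ₀ Γ₁) (f : S.adjoint.domain) :
    ((f : H), S.adjoint f) ∈ S.graph ↔ Γ₀ f = 0 ∧ Γ₁ f = 0 := by
  constructor
  · intro hf
    have h1 : ∀ y : S.adjoint.domain, inner ℂ (Γ₀ y) (Γ₁ f) = inner ℂ (Γ₁ y) (Γ₀ f) := by
      intro y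
      have h2 := hΓ.1 f y
      have h3 := (mem_graph_adjoint hS.1).1 (mem_graph_adjoint_self y) _ _ hf
      have h4 : inner ℂ (y : H) (S.adjoint f) = inner ℂ (S.adjoint y) (f : H) := by
        rw [← inner_conj_symm, h3, inner_conj_symm]
      rw [h4, sub_self] at h2
      exact (sub_eq_zero.1 h2.symm)
    obtain ⟨y, hy⟩ := exists_eq_of_surjective_prod hΓ.2 (Γ₁ f) 0
    obtain ⟨z, hz⟩ := exists_eq_of_surjective_prod hΓ.2 0 (Γ₀ f)
    have hy1 := h1 y
    have hz1 := h1 z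
    rw [hy.1, hy.2, inner_zero_left, inner_self_eq_zero] at hy1
    rw [hz.1, hz.2, inner_zero_left, eq_comm, inner_self_eq_zero] at hz1
    exact ⟨hz1, hy1⟩
  · rintro ⟨h0, h1⟩
    apply mem_graph_of_forall_adjoint hS.1 hS.2.1
    intro a c hac
    obtain ⟨y, rfl, rfl⟩ := (LinearPMap.mem_graph_iff _).1 hac
    have := hΓ.1 f y
    rw [h0, h1, inner_zero_right, inner_zero_right, sub_self] at this
    exact (sub_eq_zero.1 this).symm

omit [CompleteSpace H] in
theorem dense_domain_of_le (hS : Dense (S.domain : Set H)) (h : S ≤ A) :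
    Dense (A.domain : Set H) :=
  hS.mono h.1

theorem adjoint_le_adjoint (hS : Dense (S.domain : Set H)) (h : S ≤ A) :
    A.adjoint ≤ S.adjoint := by
  rw [le_iff_graph]
  intro x y hxy
  rw [mem_graph_adjoint (dense_domain_of_le hS h)] at hxy
  rw [mem_graph_adjoint hS]
  exact fun a c hac => hxy a c (le_iff_graph.1 h _ _ hac)

theorem IsBoundaryTriplet.mem_graph_adjoint_iff (hS : IsClosedSymmetric S)
    (hΓ : IsBoundaryTriplet S Γ₀ Γ₁) (hSA : S ≤ A) (hAS : A ≤ S.adjoint)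
    (f : S.adjoint.domain) :
    ((f : H), S.adjoint f) ∈ A.adjoint.graph ↔
      ∀ g : S.adjoint.domain, ((g : H), S.adjoint g) ∈ A.graph →
        inner ℂ (Γ₀ g) (Γ₁ f) = inner ℂ (Γ₁ g) (Γ₀ f) := by
  rw [mem_graph_adjoint (dense_domain_of_le hS.1 hSA)]
  constructor
  · intro h g hg
    have := hΓ.1 f g
    rw [h _ _ hg, sub_self] at this
    exact sub_eq_zero.1 this.symm
  · intro h a c hac
    obtain ⟨g, rfl, rfl⟩ := (LinearPMap.mem_graph_iff _).1 (le_iff_graph.1 hAS _ _ hac)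
    have := hΓ.1 f g
    rw [h _ hac, sub_self] at this
    exact (sub_eq_zero.1 this).symm

/-! ### The maps Ω₊, Ω₋ and the extensions A_K -/

theorem ofReal_one_div_sqrt_two_sq :
    ((1 / Real.sqrt 2 : ℝ) : ℂ) * ((1 / Real.sqrt 2 : ℝ) : ℂ) = 1 / 2 := by
  rw [← ofReal_mul, div_mul_div_comm, Real.mul_self_sqrt (by norm_num)]
  norm_num

/-- The Cayley transform diagonalizes the symplectic boundary form, so that self-orthogonality
becomes a unitarity condition on K. -/
theorem inner_omega_sub_inner_omega {D : Type*} [AddCommGroup D] [Module ℂ D]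
    (Γ₀ Γ₁ : D →ₗ[ℂ] G) (f g : D) :
    inner ℂ (omegaPlus Γ₀ Γ₁ g) (omegaPlus Γ₀ Γ₁ f) -
      inner ℂ (omegaMinus Γ₀ Γ₁ g) (omegaMinus Γ₀ Γ₁ f) =
      -I * (inner ℂ (Γ₀ g) (Γ₁ f) - inner ℂ (Γ₁ g) (Γ₀ f)) := by
  simp only [omegaPlus, omegaMinus, LinearMap.smul_apply, LinearMap.add_apply,
    LinearMap.sub_apply, inner_smul_left, inner_smul_right, inner_add_left, inner_add_right,
    inner_sub_left, inner_sub_right, conj_ofReal, conj_I]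
  linear_combination (2 * I * inner ℂ (Γ₁ g) (Γ₀ f) - 2 * I * inner ℂ (Γ₀ g) (Γ₁ f)) *
    ofReal_one_div_sqrt_two_sq

theorem exists_omega {D : Type*} [AddCommGroup D] [Module ℂ D] {Γ₀ Γ₁ : D →ₗ[ℂ] G}
    (h : Function.Surjective (Γ₀.prod Γ₁)) (u v : G) :
    ∃ f : D, omegaPlus Γ₀ Γ₁ f = u ∧ omegaMinus Γ₀ Γ₁ f = v := by
  set c : ℂ := ((1 / Real.sqrt 2 : ℝ) : ℂ) with hc
  have hcc : c * c = 1 / 2 := ofReal_one_div_sqrt_two_sq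
  -- Inverse of the Cayley transform: Γ₀f = -i(u - v)/√2 and Γ₁f = (u + v)/√2.
  obtain ⟨f, hf⟩ := exists_eq_of_surjective_prod h ((-I * c) • (u - v)) (c • (u + v))
  refine ⟨f, ?_, ?_⟩
  · simp only [omegaPlus, LinearMap.smul_apply, LinearMap.add_apply, hf, ← hc]
    match_scalars
    · linear_combination (1 - I * I) * hcc - (1 / 2) * I_mul_I
    · linear_combination (1 + I * I) * hcc + (1 / 2) * I_mul_I
  · simp only [omegaMinus, LinearMap.smul_apply, LinearMap.sub_apply, hf, ← hc]
    match_scalars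
    · linear_combination (1 + I * I) * hcc + (1 / 2) * I_mul_I
    · linear_combination (1 - I * I) * hcc - (1 / 2) * I_mul_I

theorem mem_graph_extensionOf {K : G →ₗ[ℂ] G} (f : S.adjoint.domain) :
    ((f : H), S.adjoint f) ∈ (extensionOf S Γ₀ Γ₁ K).graph ↔
      K (omegaPlus Γ₀ Γ₁ f) = omegaMinus Γ₀ Γ₁ f := by
  rw [LinearPMap.mem_graph_iff]
  constructor
  · rintro ⟨w, h1, -⟩
    obtain ⟨⟨g, hg, hgx⟩, -⟩ := w.2
    obtain rfl : g = f := Subtype.ext (hgx.trans h1)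
    exact hg
  · intro h
    refine ⟨⟨f, ⟨f, h, rfl⟩, f.2⟩, rfl, ?_⟩
    exact LinearPMap.domRestrict_apply rfl

theorem extensionOf_le (K : G →ₗ[ℂ] G) : extensionOf S Γ₀ Γ₁ K ≤ S.adjoint :=
  LinearPMap.domRestrict_le

theorem le_extensionOf (hS : IsClosedSymmetric S) (hΓ : IsBoundaryTriplet S Γ₀ Γ₁)
    (K : G →ₗ[ℂ] G) : S ≤ extensionOf S Γ₀ Γ₁ K := by
  rw [le_iff_graph]
  intro x y hxy
  obtain ⟨f, rfl, rfl⟩ := (LinearPMap.mem_graph_iff _).1 (le_iff_graph.1 hS.le_adjoint _ _ hxy)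
  obtain ⟨h0, h1⟩ := (hΓ.mem_graph_iff hS f).1 hxy
  rw [mem_graph_extensionOf]
  simp [omegaPlus, omegaMinus, h0, h1]

/-- Two operators between `S` and `S*` agree as soon as they agree on `D(S*)`. -/
theorem eq_of_le_adjoint {A B : H →ₗ.[ℂ] H} (hA : A ≤ S.adjoint) (hB : B ≤ S.adjoint)
    (h : ∀ f : S.adjoint.domain, ((f : H), S.adjoint f) ∈ A.graph ↔
      ((f : H), S.adjoint f) ∈ B.graph) : A = B := by
  rw [eq_iff_graph]
  intro x y
  constructor
  · intro hxy
    obtain ⟨f, rfl, rfl⟩ := (LinearPMap.mem_graph_iff _).1 (le_iff_graph.1 hA _ _ hxy)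
    exact (h f).1 hxy
  · intro hxy
    obtain ⟨f, rfl, rfl⟩ := (LinearPMap.mem_graph_iff _).1 (le_iff_graph.1 hB _ _ hxy)
    exact (h f).2 hxy

theorem extensionOf_injective (hΓ : IsBoundaryTriplet S Γ₀ Γ₁) {K K' : G →ₗ[ℂ] G}
    (h : extensionOf S Γ₀ Γ₁ K = extensionOf S Γ₀ Γ₁ K') : K = K' := by
  ext u
  obtain ⟨f, hf, hf'⟩ := exists_omega hΓ.2 u (K u)
  have h1 : K (omegaPlus Γ₀ Γ₁ f) = omegaMinus Γ₀ Γ₁ f := by rw [hf, hf']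
  rw [← mem_graph_extensionOf, h, mem_graph_extensionOf, hf, hf'] at h1
  exact h1.symm

/-- The pairs (u, Ku) exhaust the boundary values of A_K, so the Green identity reads Ω₊f = K*Ω₋f.
-/
theorem mem_graph_adjoint_extensionOf (hS : IsClosedSymmetric S)
    (hΓ : IsBoundaryTriplet S Γ₀ Γ₁) {K : G →ₗ[ℂ] G} (f : S.adjoint.domain) :
    ((f : H), S.adjoint f) ∈ (extensionOf S Γ₀ Γ₁ K).adjoint.graph ↔
      ∀ u : G, inner ℂ u (omegaPlus Γ₀ Γ₁ f) = inner ℂ (K u) (omegaMinus Γ₀ Γ₁ f) := by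
  rw [hΓ.mem_graph_adjoint_iff hS (le_extensionOf hS hΓ K) (extensionOf_le K)]
  simp only [mem_graph_extensionOf]
  constructor
  · intro h u
    obtain ⟨g, hg, hg'⟩ := exists_omega hΓ.2 u (K u)
    have h1 := inner_omega_sub_inner_omega Γ₀ Γ₁ f g
    rw [h g (by rw [hg, hg']), sub_self, mul_zero, hg, hg'] at h1
    exact sub_eq_zero.1 h1
  · intro h g hg
    have h1 := inner_omega_sub_inner_omega Γ₀ Γ₁ f g
    rw [h, hg, sub_self] at h1
    simpa [sub_eq_zero] using h1.symm

/-! ### Operators commuting with `S*` -/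

/-- The restriction to `D(S*)` of a bounded operator which commutes with `S*`. -/
def domainMap (S : H →ₗ.[ℂ] H) (C : H →L[ℂ] H) (hC : GraphInvariant S.adjoint C) :
    S.adjoint.domain →ₗ[ℂ] S.adjoint.domain :=
  (C : H →ₗ[ℂ] H).restrict fun f hf =>
    LinearPMap.mem_domain_of_mem_graph (hC _ _ (mem_graph_adjoint_self ⟨f, hf⟩))

theorem coe_domainMap {C : H →L[ℂ] H} (hC : GraphInvariant S.adjoint C) (f : S.adjoint.domain) :
    (domainMap S C hC f : H) = C f :=
  rfl

theorem adjoint_domainMap {C : H →L[ℂ] H} (hC : GraphInvariant S.adjoint C)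
    (f : S.adjoint.domain) : S.adjoint (domainMap S C hC f) = C (S.adjoint f) := by
  have h1 := hC _ _ (mem_graph_adjoint_self f)
  obtain ⟨g, hg, hg'⟩ := (LinearPMap.mem_graph_iff _).1 h1
  obtain rfl : g = domainMap S C hC f := Subtype.ext hg
  exact hg'

theorem Intertwines.apply_domainMap {C : H →L[ℂ] H} {C₀ : G →L[ℂ] G}
    {Γ : S.adjoint.domain →ₗ[ℂ] G} (h : Intertwines Γ C C₀) (hC : GraphInvariant S.adjoint C)
    (f : S.adjoint.domain) : Γ (domainMap S C hC f) = C₀ (Γ f) := by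
  obtain ⟨_, h2⟩ := h f
  exact h2.symm

theorem omegaPlus_domainMap {C : H →L[ℂ] H} {C₀ : G →ₗ[ℂ] G} {hC : GraphInvariant S.adjoint C}
    (h0 : ∀ f, Γ₀ (domainMap S C hC f) = C₀ (Γ₀ f))
    (h1 : ∀ f, Γ₁ (domainMap S C hC f) = C₀ (Γ₁ f)) (f : S.adjoint.domain) :
    omegaPlus Γ₀ Γ₁ (domainMap S C hC f) = C₀ (omegaPlus Γ₀ Γ₁ f) := by
  simp [omegaPlus, h0, h1]

theorem omegaMinus_domainMap {C : H →L[ℂ] H} {C₀ : G →ₗ[ℂ] G} {hC : GraphInvariant S.adjoint C}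
    (h0 : ∀ f, Γ₀ (domainMap S C hC f) = C₀ (Γ₀ f))
    (h1 : ∀ f, Γ₁ (domainMap S C hC f) = C₀ (Γ₁ f)) (f : S.adjoint.domain) :
    omegaMinus Γ₀ Γ₁ (domainMap S C hC f) = C₀ (omegaMinus Γ₀ Γ₁ f) := by
  simp [omegaMinus, h0, h1]

theorem graphInvariant_extensionOf_iff (hΓ : IsBoundaryTriplet S Γ₀ Γ₁) {C : H →L[ℂ] H}
    {C₀ : G →ₗ[ℂ] G} {hC : GraphInvariant S.adjoint C}
    (h0 : ∀ f, Γ₀ (domainMap S C hC f) = C₀ (Γ₀ f))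
    (h1 : ∀ f, Γ₁ (domainMap S C hC f) = C₀ (Γ₁ f)) {K : G →ₗ[ℂ] G} :
    GraphInvariant (extensionOf S Γ₀ Γ₁ K) C ↔ K ∘ₗ C₀ = C₀ ∘ₗ K := by
  constructor
  · intro h
    ext u
    obtain ⟨f, hf, hf'⟩ := exists_omega hΓ.2 u (K u)
    have h2 := h _ _ ((mem_graph_extensionOf (Γ₀ := Γ₀) (Γ₁ := Γ₁) (K := K) f).2
      (by rw [hf, hf']))
    rw [← adjoint_domainMap hC, ← coe_domainMap hC, mem_graph_extensionOf,
      omegaPlus_domainMap h0 h1, omegaMinus_domainMap h0 h1, hf, hf'] at h2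
    exact h2
  · intro h x y hxy
    obtain ⟨f, rfl, rfl⟩ := (LinearPMap.mem_graph_iff _).1 (le_iff_graph.1 (extensionOf_le K) _ _ hxy)
    rw [mem_graph_extensionOf] at hxy
    rw [← adjoint_domainMap hC, ← coe_domainMap hC, mem_graph_extensionOf,
      omegaPlus_domainMap h0 h1, omegaMinus_domainMap h0 h1, ← hxy]
    exact LinearMap.congr_fun h _

theorem extensionOf_mem_sigmaJ_iff [FiniteDimensional ℂ G] (hS : IsClosedSymmetric S)
    (hΓ : IsBoundaryTriplet S Γ₀ Γ₁) {J : H →L[ℂ] H}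
    (hJ : J ∘L J = ContinuousLinearMap.id ℂ H) {Jb : G →L[ℂ] G}
    (hJJ : ∀ u, Jb (Jb u) = u)
    (hJS : GraphInvariant S.adjoint J)
    (hJ₀ : Intertwines Γ₀ J Jb) (hJ₁ : Intertwines Γ₁ J Jb) {K : G →ₗ[ℂ] G} :
    extensionOf S Γ₀ Γ₁ K ∈ sigmaJ J S ↔ IsJUnitary Jb K := by
  have hle := le_extensionOf hS hΓ K
  have h0 : ∀ f, Γ₀ (domainMap S J hJS f) = (Jb : G →ₗ[ℂ] G) (Γ₀ f) := hJ₀.apply_domainMap hJS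
  have h1 : ∀ f, Γ₁ (domainMap S J hJS f) = (Jb : G →ₗ[ℂ] G) (Γ₁ f) := hJ₁.apply_domainMap hJS
  have hJJ' := apply_apply_of_comp_self hJ
  -- The boundary values (u, v) of f are arbitrary, so J-self-adjointness is a statement about the
  -- graph of K alone: it equals its own orthogonal complement for the indefinite form.
  have key : extensionOf S Γ₀ Γ₁ K ∈ sigmaJ J S ↔
      ∀ u v, (∀ g, inner ℂ g (Jb u) = inner ℂ (K g) (Jb v)) ↔ K u = v := by
    have hiff : extensionOf S Γ₀ Γ₁ K ∈ sigmaJ J S ↔ ∀ f : S.adjoint.domain,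
        (J f, J (S.adjoint f)) ∈ (extensionOf S Γ₀ Γ₁ K).adjoint.graph ↔
          ((f : H), S.adjoint f) ∈ (extensionOf S Γ₀ Γ₁ K).graph := by
      change _ ∧ _ ↔ _
      rw [isJSelfAdjoint_iff hJ]
      refine ⟨fun h f => h.2 _ _, fun h => ⟨hle, fun x y => ?_⟩⟩
      constructor
      · intro hxy
        have h2 := hJS _ _ (le_iff_graph.1 (adjoint_le_adjoint hS.1 hle) _ _ hxy)
        rw [hJJ', hJJ'] at h2
        obtain ⟨f, rfl, rfl⟩ := (LinearPMap.mem_graph_iff _).1 h2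
        exact (h f).1 hxy
      · intro hxy
        obtain ⟨f, rfl, rfl⟩ :=
          (LinearPMap.mem_graph_iff _).1 (le_iff_graph.1 (extensionOf_le K) _ _ hxy)
        exact (h f).2 hxy
    rw [hiff]
    simp only [← adjoint_domainMap hJS, ← coe_domainMap hJS, mem_graph_adjoint_extensionOf hS hΓ,
      mem_graph_extensionOf, omegaPlus_domainMap h0 h1, omegaMinus_domainMap h0 h1]
    constructor
    · intro h u v
      obtain ⟨f, rfl, rfl⟩ := exists_omega hΓ.2 u v
      exact h f
    · intro h f
      exact h _ _
  rw [key]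
  constructor
  · intro h
    refine ⟨fun v => ?_, fun x y => ?_⟩
    · refine ⟨Jb (K.adjoint (Jb v)), (h _ _).1 fun g => ?_⟩
      rw [hJJ, LinearMap.adjoint_inner_right]
    · exact ((h x (K x)).2 rfl y).symm
  · rintro ⟨hsurj, hK⟩ u v
    constructor
    · intro h
      have h2 : Jb (K u) = Jb v := by
        refine ext_inner_left ℂ fun w => ?_
        obtain ⟨g, rfl⟩ := hsurj w
        rw [hK, h]
      rw [← hJJ (K u), h2, hJJ]
    · rintro rfl g
      exact (hK u g).symm

end

section


variable {H : Type*} [NormedAddCommGroup H] [InnerProductSpace ℂ H] [CompleteSpace H]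
variable {G : Type*} [NormedAddCommGroup G] [InnerProductSpace ℂ G]
variable {S A : H →ₗ.[ℂ] H} {Γ₀ Γ₁ : S.adjoint.domain →ₗ[ℂ] G}

/-! ### The two symmetries of the boundary space -/

/-- The operators `P` and `Q` act as `diag(1, -1)` and as the flip in an orthonormal basis. -/
structure IsPauliPair (b : OrthonormalBasis (Fin 2) ℂ G) (P Q : G →L[ℂ] G) : Prop where
  P_zero : P (b 0) = b 0
  P_one : P (b 1) = -b 1
  Q_zero : Q (b 0) = b 1
  Q_one : Q (b 1) = b 0

namespace IsPauliPair

variable {b : OrthonormalBasis (Fin 2) ℂ G} {P Q : G →L[ℂ] G}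

theorem apply_P (h : IsPauliPair b P Q) (x : G) :
    P x = inner ℂ (b 0) x • b 0 - inner ℂ (b 1) x • b 1 := by
  conv_lhs => rw [← b.sum_repr' x]
  simp [Fin.sum_univ_two, h.P_zero, h.P_one, sub_eq_add_neg]

theorem apply_Q (h : IsPauliPair b P Q) (x : G) :
    Q x = inner ℂ (b 0) x • b 1 + inner ℂ (b 1) x • b 0 := by
  conv_lhs => rw [← b.sum_repr' x]
  simp [Fin.sum_univ_two, h.Q_zero, h.Q_one]

theorem P_P (h : IsPauliPair b P Q) (x : G) : P (P x) = x := by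
  rw [h.apply_P x, map_sub, map_smul, map_smul, h.P_zero, h.P_one]
  conv_rhs => rw [← b.sum_repr' x]
  simp [Fin.sum_univ_two]

theorem inner_P (h : IsPauliPair b P Q) (x y : G) : inner ℂ (P x) y = inner ℂ x (P y) := by
  rw [h.apply_P x, h.apply_P y]
  simp only [inner_sub_left, inner_smul_left, inner_conj_symm, inner_sub_right, inner_smul_right]
  ring

theorem inner_Q (h : IsPauliPair b P Q) (x y : G) : inner ℂ (Q x) y = inner ℂ x (Q y) := by
  rw [h.apply_Q x, h.apply_Q y]
  simp only [inner_add_left, inner_smul_left, inner_conj_symm, inner_add_right, inner_smul_right]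
  ring

/-- Schur's lemma for an irreducible pair: commuting with P makes T diagonal, and the flip Q equates
the two diagonal entries. -/
theorem exists_eq_smul_of_commute (h : IsPauliPair b P Q) (T : G →ₗ[ℂ] G)
    (hP : ∀ x, T (P x) = P (T x)) (hQ : ∀ x, T (Q x) = Q (T x)) :
    ∃ m : ℂ, ∀ x, T x = m • x := by
  have h0 : T (b 0) = inner ℂ (b 0) (T (b 0)) • b 0 := by
    have h1 := hP (b 0)
    rw [h.P_zero, h.apply_P] at h1
    have h2 := b.sum_repr' (T (b 0))
    rw [Fin.sum_univ_two] at h2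
    have h3 : (2 : ℂ) • T (b 0) = (2 : ℂ) • (inner ℂ (b 0) (T (b 0)) • b 0) := by
      rw [two_smul, two_smul]
      nth_rewrite 1 [h1]
      nth_rewrite 3 [← h2]
      abel
    exact smul_right_injective G (two_ne_zero : (2 : ℂ) ≠ 0) h3
  set m : ℂ := inner ℂ (b 0) (T (b 0)) with hm
  clear_value m
  have h1 : T (b 1) = m • b 1 := by
    rw [← h.Q_zero, hQ, h0, map_smul]
  refine ⟨m, fun x => ?_⟩
  rw [← b.sum_repr' x]
  simp only [Fin.sum_univ_two, map_add, map_smul, h0, h1, smul_add]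
  rw [smul_comm m, smul_comm m]

end IsPauliPair

/-! ### The `γ`-field at `i` -/

/-- The restriction of S* to ker Γ₀ is symmetric, so it cannot have the non-real eigenvalue i. -/
theorem eq_zero_of_adjoint_eq_I_smul (hΓ : IsBoundaryTriplet S Γ₀ Γ₁) {f : S.adjoint.domain}
    (hf : S.adjoint f = I • (f : H)) (h0 : Γ₀ f = 0) : f = 0 := by
  have h := hΓ.1 f f
  rw [h0, inner_zero_left, inner_zero_right, hf, inner_smul_left, inner_smul_right, conj_I] at h
  have h2 : inner ℂ (f : H) (f : H) = 0 := by
    have : (2 * I) * inner ℂ (f : H) (f : H) = 0 := by linear_combination h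
    simpa using this
  exact Subtype.ext (inner_self_eq_zero.1 h2)

/-- Γ₀ is injective on the defect subspace at i, and equality of dimensions makes it bijective; γ is
the inverse. Positive rank is needed because `finrank` is also 0 for infinite-dimensional spaces. -/
theorem exists_gammaField [FiniteDimensional ℂ G] (hΓ : IsBoundaryTriplet S Γ₀ Γ₁)
    (hd : Module.finrank ℂ (defectSubspace S I) = Module.finrank ℂ G)
    (hpos : 0 < Module.finrank ℂ G) :
    ∃ γ : G →ₗ[ℂ] S.adjoint.domain, (∀ g, Γ₀ (γ g) = g) ∧
      ∀ g, S.adjoint (γ g) = I • (γ g : H) := by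
  have hmem : ∀ x ∈ defectSubspace S I, (x, I • x) ∈ S.adjoint.graph := fun x hx => hx
  have hle : defectSubspace S I ≤ S.adjoint.domain := fun x hx =>
    LinearPMap.mem_domain_of_mem_graph (hmem x hx)
  have hval : ∀ n : defectSubspace S I,
      S.adjoint (Submodule.inclusion hle n) = I • (n : H) := by
    intro n
    obtain ⟨g, hg, hg'⟩ := (LinearPMap.mem_graph_iff _).1 (hmem n n.2)
    obtain rfl : g = Submodule.inclusion hle n := Subtype.ext hg
    exact hg'
  have : FiniteDimensional ℂ (defectSubspace S I) :=
    FiniteDimensional.of_finrank_pos (hd ▸ hpos)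
  let T : defectSubspace S I →ₗ[ℂ] G := Γ₀ ∘ₗ Submodule.inclusion hle
  have hT : Function.Injective T := by
    rw [injective_iff_map_eq_zero]
    intro n hn
    have := eq_zero_of_adjoint_eq_I_smul hΓ (hval n) hn
    exact Subtype.ext (congrArg (fun x : S.adjoint.domain => (x : H)) this)
  let e := T.linearEquivOfInjective hT hd
  refine ⟨Submodule.inclusion hle ∘ₗ e.symm, fun g => ?_, fun g => hval _⟩
  exact e.apply_symm_apply g

/-! ### Boundary operators of `C`-symmetries -/

/-- An operator commuting with `S*` whose action leaves `ker Γ₀` invariant is carried by the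
`γ`-field: the relation `Γ₀ C = C₀ Γ₀` holds for an operator `C₀` in the boundary space. -/
theorem exists_boundary_operator {γ : G →ₗ[ℂ] S.adjoint.domain}
    (hγ₀ : ∀ g, Γ₀ (γ g) = g) {C : H →L[ℂ] H} (hC : GraphInvariant S.adjoint C)
    (hker : ∀ f, Γ₀ f = 0 → Γ₀ (domainMap S C hC f) = 0) (f : S.adjoint.domain) :
    Γ₀ (domainMap S C hC f) = Γ₀ (domainMap S C hC (γ (Γ₀ f))) := by
  have h := hker (f - γ (Γ₀ f)) (by rw [map_sub, hγ₀, sub_self])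
  rw [map_sub, map_sub] at h
  exact sub_eq_zero.1 h

/-- C commutes with S*, so it preserves the defect subspace, whose elements are determined by their
value under Γ₀. -/
theorem domainMap_gammaField (hΓ : IsBoundaryTriplet S Γ₀ Γ₁) {γ : G →ₗ[ℂ] S.adjoint.domain}
    (hγ₀ : ∀ g, Γ₀ (γ g) = g) (hγ : ∀ g, S.adjoint (γ g) = I • (γ g : H)) {C : H →L[ℂ] H}
    (hC : GraphInvariant S.adjoint C) (g : G) :
    domainMap S C hC (γ g) = γ (Γ₀ (domainMap S C hC (γ g))) := by
  rw [← sub_eq_zero]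
  apply eq_zero_of_adjoint_eq_I_smul hΓ
  · rw [LinearPMap.map_sub, adjoint_domainMap, hγ, hγ, map_smul, Submodule.coe_sub, smul_sub,
      coe_domainMap]
  · rw [map_sub, hγ₀, sub_self]

theorem exists_boundary_cSymmetry {b : OrthonormalBasis (Fin 2) ℂ G} {Jb Rb : G →L[ℂ] G}
    (hb : IsPauliPair b Jb Rb) (hΓ : IsBoundaryTriplet S Γ₀ Γ₁)
    (hd : Module.finrank ℂ (defectSubspace S I) = 2) {J R : H →L[ℂ] H}
    (hJ : IsFundamentalSymmetry J) (hR : IsFundamentalSymmetry R)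
    (hJS : GraphInvariant S.adjoint J) (hRS : GraphInvariant S.adjoint R)
    (hJ₀ : Intertwines Γ₀ J Jb) (hJ₁ : Intertwines Γ₁ J Jb)
    (hR₀ : Intertwines Γ₀ R Rb) (hR₁ : Intertwines Γ₁ R Rb)
    {C : H →L[ℂ] H} (hCS : GraphInvariant S.adjoint C)
    (hCC : C ∘L C = ContinuousLinearMap.id ℂ H) (hJC : StrictlyPos (J ∘L C))
    (hker : ∀ f, Γ₀ f = 0 → Γ₀ (domainMap S C hCS f) = 0) :
    ∃ C₀ : G →ₗ[ℂ] G, (∀ x, C₀ (C₀ x) = x) ∧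
      (∀ x y, inner ℂ (Jb (C₀ x)) y = inner ℂ x (Jb (C₀ y))) ∧
      (∀ x, x ≠ 0 → 0 < (inner ℂ (Jb (C₀ x)) x).re) ∧
      (∀ f, Γ₀ (domainMap S C hCS f) = C₀ (Γ₀ f)) ∧
      (∀ f, Γ₁ (domainMap S C hCS f) = C₀ (Γ₁ f)) := by
  have : FiniteDimensional ℂ G := b.toBasis.finiteDimensional_of_finite
  have hG : Module.finrank ℂ G = 2 := by simpa using Module.finrank_eq_card_basis b.toBasis
  obtain ⟨γ, hγ₀, hγ⟩ := exists_gammaField hΓ (hd.trans hG.symm) (hG ▸ two_pos)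
  have hC₀ : ∀ f, Γ₀ (domainMap S C hCS f) = (Γ₀ ∘ₗ domainMap S C hCS ∘ₗ γ) (Γ₀ f) :=
    exists_boundary_operator hγ₀ hCS hker
  have hCγ : ∀ g, domainMap S C hCS (γ g) = γ ((Γ₀ ∘ₗ domainMap S C hCS ∘ₗ γ) g) :=
    domainMap_gammaField hΓ hγ₀ hγ hCS
  generalize Γ₀ ∘ₗ domainMap S C hCS ∘ₗ γ = C₀ at hC₀ hCγ
  have hJγ : ∀ g, domainMap S J hJS (γ g) = γ (Jb g) := fun g => by
    rw [domainMap_gammaField hΓ hγ₀ hγ, hJ₀.apply_domainMap, hγ₀]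
  have hRγ : ∀ g, domainMap S R hRS (γ g) = γ (Rb g) := fun g => by
    rw [domainMap_gammaField hΓ hγ₀ hγ, hR₀.apply_domainMap, hγ₀]
  have hCγ' : ∀ g, C (γ g : H) = γ (C₀ g) := fun g =>
    congrArg (fun x : S.adjoint.domain => (x : H)) (hCγ g)
  have hJγ' : ∀ g, J (γ g : H) = γ (Jb g) := fun g =>
    congrArg (fun x : S.adjoint.domain => (x : H)) (hJγ g)
  have hRγ' : ∀ g, R (γ g : H) = γ (Rb g) := fun g =>
    congrArg (fun x : S.adjoint.domain => (x : H)) (hRγ g)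
  -- the form induced by the `γ`-field is a multiple of the inner product
  obtain ⟨s, hs⟩ : ∃ s : ℂ, ∀ x y, inner ℂ (γ x : H) (γ y : H) = s * inner ℂ x y := by
    let γc : G →L[ℂ] H := LinearMap.toContinuousLinearMap (S.adjoint.domain.subtype ∘ₗ γ)
    have : CompleteSpace G := FiniteDimensional.complete ℂ G
    have hγc : ∀ x y, inner ℂ x ((γc.adjoint ∘L γc) y) = inner ℂ (γ x : H) (γ y : H) :=
      fun x y => ContinuousLinearMap.adjoint_inner_right γc x (γc y)
    obtain ⟨s, hs⟩ := hb.exists_eq_smul_of_commute ((γc.adjoint ∘L γc : G →L[ℂ] G) : G →ₗ[ℂ] G)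
      (fun x => ext_inner_left ℂ fun y => by
        rw [← hb.inner_P, ContinuousLinearMap.coe_coe, hγc, hγc, ← hJγ', ← hJγ', hJ.inner_left])
      (fun x => ext_inner_left ℂ fun y => by
        rw [← hb.inner_Q, ContinuousLinearMap.coe_coe, hγc, hγc, ← hRγ', ← hRγ', hR.inner_left])
    refine ⟨s, fun x y => ?_⟩
    rw [← hγc, ← inner_smul_right, ← hs, ContinuousLinearMap.coe_coe]
  have hγne : ∀ x, x ≠ 0 → (γ x : H) ≠ 0 := by
    intro x hx h
    apply hx
    rw [← hγ₀ x, show γ x = 0 from Subtype.ext h, map_zero]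
  obtain ⟨t, ht, rfl⟩ : ∃ t : ℝ, 0 < t ∧ s = t := by
    refine ⟨‖(γ (b 0) : H)‖ ^ 2, ?_, ?_⟩
    · have := norm_pos_iff.2 (hγne (b 0) (b.orthonormal.ne_zero 0))
      positivity
    · have := hs (b 0) (b 0)
      rw [inner_self_eq_norm_sq_to_K, inner_self_eq_norm_sq_to_K, b.orthonormal.1 0] at this
      simpa using this.symm
  have htc : (t : ℂ) ≠ 0 := by exact_mod_cast ht.ne'
  -- the Weyl function at `i` is a scalar
  obtain ⟨m, hm⟩ : ∃ m : ℂ, ∀ x, (Γ₁ ∘ₗ γ) x = m • x :=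
    hb.exists_eq_smul_of_commute (Γ₁ ∘ₗ γ)
      (fun x => by
        rw [LinearMap.comp_apply, LinearMap.comp_apply, ← hJγ, hJ₁.apply_domainMap])
      (fun x => by
        rw [LinearMap.comp_apply, LinearMap.comp_apply, ← hRγ, hR₁.apply_domainMap])
  have hJCs : ∀ x y, inner ℂ (J (C x)) y = inner ℂ x (J (C y)) := fun x y => by
    have := ContinuousLinearMap.adjoint_inner_right (J ∘L C) x y
    rw [← ContinuousLinearMap.star_eq_adjoint, hJC.1.star_eq] at this
    exact this.symm
  have hself : ∀ x y, inner ℂ (Jb (C₀ x)) y = inner ℂ x (Jb (C₀ y)) := fun x y => by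
    apply mul_left_cancel₀ htc
    rw [← hs, ← hs, ← hJγ', ← hJγ', ← hCγ', ← hCγ', hJCs]
  refine ⟨C₀, fun x => ?_, hself, fun x hx => ?_, hC₀, fun f => ?_⟩
  · have h1 : (γ (C₀ (C₀ x)) : H) = γ x := by
      rw [← hCγ', ← hCγ', apply_apply_of_comp_self hCC]
    rw [← hγ₀ (C₀ (C₀ x)), show γ (C₀ (C₀ x)) = γ x from Subtype.ext h1, hγ₀]
  · have h1 := hJC.2 _ (hγne x hx)
    rw [ContinuousLinearMap.comp_apply, hCγ', hJγ', hs, re_ofReal_mul] at h1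
    exact pos_of_mul_pos_right h1 ht.le
  · have hγpart : ∀ g, Γ₁ (domainMap S C hCS (γ g)) = C₀ (Γ₁ (γ g)) := fun g => by
      have h1 := hm (C₀ g)
      have h2 := hm g
      rw [LinearMap.comp_apply] at h1 h2
      rw [hCγ, h1, h2, map_smul]
    have hkerpart : ∀ f, Γ₀ f = 0 → Γ₁ (domainMap S C hCS f) = C₀ (Γ₁ f) := by
      -- For f in ker Γ₀ the Green identity against γh isolates (h, Γ₁Cf). Moving C to the other
      -- side as C* = JCJ gives γ(𝒥C₀𝒥h), and the same identity for f then yields (h, C₀Γ₁f).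
      intro f hf
      refine ext_inner_left ℂ fun h => ?_
      have h1 := hΓ.1 (domainMap S C hCS f) (γ h)
      have h2 := hΓ.1 f (γ (Jb (C₀ (Jb h))))
      rw [hker f hf, inner_zero_right, sub_zero, hγ₀, adjoint_domainMap, coe_domainMap] at h1
      rw [hf, inner_zero_right, sub_zero, hγ₀] at h2
      have hCadj : ∀ x y, inner ℂ x (C y) = inner ℂ (J (C (J x))) y := fun x y => by
        rw [hJCs, hJ.inner_left, apply_apply_of_comp_self hJ.2]
      rw [hCadj, hCadj, hγ, map_smul, map_smul, map_smul, hJγ', hCγ', hJγ', ← hγ, h2,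
        hself, hb.inner_P, hb.P_P] at h1
      exact h1.symm
    -- D(S*) is the sum of ker Γ₀ and the defect subspace at i; both parts are now settled.
    have h1 := hkerpart (f - γ (Γ₀ f)) (by rw [map_sub, hγ₀, sub_self])
    rw [map_sub, map_sub, map_sub, map_sub, hγpart] at h1
    exact sub_left_inj.1 h1

end

section


variable {H : Type*} [NormedAddCommGroup H] [InnerProductSpace ℂ H] [CompleteSpace H]
variable {G : Type*} [NormedAddCommGroup G] [InnerProductSpace ℂ G]
variable {S A : H →ₗ.[ℂ] H} {Γ Γ₀ Γ₁ : S.adjoint.domain →ₗ[ℂ] G}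

/-! ### Intertwining relations -/

theorem Intertwines.id : Intertwines Γ (ContinuousLinearMap.id ℂ H)
    (ContinuousLinearMap.id ℂ G) := fun f => ⟨f.2, rfl⟩

theorem Intertwines.comp {T₁ T₂ : H →L[ℂ] H} {B₁ B₂ : G →L[ℂ] G} (h₁ : Intertwines Γ T₁ B₁)
    (h₂ : Intertwines Γ T₂ B₂) : Intertwines Γ (T₁ ∘L T₂) (B₁ ∘L B₂) := fun f => by
  obtain ⟨m₂, e₂⟩ := h₂ f
  obtain ⟨m₁, e₁⟩ := h₁ ⟨T₂ f, m₂⟩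
  exact ⟨m₁, by rw [ContinuousLinearMap.comp_apply, e₂, e₁]; rfl⟩

theorem Intertwines.add {T₁ T₂ : H →L[ℂ] H} {B₁ B₂ : G →L[ℂ] G} (h₁ : Intertwines Γ T₁ B₁)
    (h₂ : Intertwines Γ T₂ B₂) : Intertwines Γ (T₁ + T₂) (B₁ + B₂) := fun f => by
  obtain ⟨m₁, e₁⟩ := h₁ f
  obtain ⟨m₂, e₂⟩ := h₂ f
  exact ⟨add_mem m₁ m₂, by rw [add_apply, e₁, e₂, ← map_add]; rfl⟩

theorem Intertwines.smul {T : H →L[ℂ] H} {B : G →L[ℂ] G} (c : ℂ) (h : Intertwines Γ T B) :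
    Intertwines Γ (c • T) (c • B) := fun f => by
  obtain ⟨m, e⟩ := h f
  exact ⟨Submodule.smul_mem _ c m, by rw [smul_apply, e, ← map_smul]; rfl⟩

theorem Intertwines.linear_comb {T : H →L[ℂ] H} {B : G →L[ℂ] G} (p q : ℂ)
    (h₀ : Intertwines Γ₀ T B) (h₁ : Intertwines Γ₁ T B) :
    Intertwines (p • Γ₀ + q • Γ₁) T B := fun f => by
  obtain ⟨m, e₀⟩ := h₀ f
  obtain ⟨m, e₁⟩ := h₁ f
  exact ⟨m, by simp [e₀, e₁]⟩

theorem Intertwines.cChiOmega {J R : H →L[ℂ] H} {Jb Rb : G →L[ℂ] G} (hJ : Intertwines Γ J Jb)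
    (hR : Intertwines Γ R Rb) (χ ω : ℝ) :
    Intertwines Γ (cChiOmega J R χ ω) (cChiOmega Jb Rb χ ω) :=
  hJ.comp ((Intertwines.id.smul _).add
    ((hR.comp ((Intertwines.id.smul _).add (hJ.smul _))).smul _))

/-! ### The operators `C_{χ,ω}` -/

omit [CompleteSpace H] in
theorem GraphInvariant.cChiOmega {J R : H →L[ℂ] H} (hJ : GraphInvariant A J)
    (hR : GraphInvariant A R) (χ ω : ℝ) : GraphInvariant A (cChiOmega J R χ ω) :=
  hJ.comp (((GraphInvariant.id A).smul _).add
    ((hR.comp (((GraphInvariant.id A).smul _).add (hJ.smul _))).smul _))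

section

variable {J R : H →L[ℂ] H} (hJ : IsFundamentalSymmetry J) (hR : IsFundamentalSymmetry R)
  (hJR : J ∘L R + R ∘L J = 0)
include hJR

omit [CompleteSpace H] in
theorem anticommute_apply (x : H) : J (R x) = -R (J x) :=
  eq_neg_of_add_eq_zero_left (congrArg (fun T : H →L[ℂ] H => T x) hJR)

omit [CompleteSpace H] in
theorem anticommute_rOmega (ω : ℝ) (x : H) : J (rOmega J R ω x) = -rOmega J R ω (J x) := by
  simp [rOmega, anticommute_apply hJR]
  abel

include hJ hR

theorem rOmega_rOmega (ω : ℝ) (x : H) : rOmega J R ω (rOmega J R ω x) = x := by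
  have h : (Real.cos ω : ℂ) ^ 2 + (Real.sin ω : ℂ) ^ 2 = 1 := by
    exact_mod_cast Real.cos_sq_add_sin_sq ω
  push_cast at h
  simp only [rOmega, ContinuousLinearMap.comp_apply, add_apply,
    smul_apply, ContinuousLinearMap.id_apply, map_add, map_smul,
    anticommute_apply hJR, apply_apply_of_comp_self hJ.2, map_neg, apply_apply_of_comp_self hR.2]
  match_scalars
  · linear_combination h - Complex.sin ω ^ 2 * I_sq
  · ring

theorem inner_rOmega (ω : ℝ) (x y : H) :
    inner ℂ (rOmega J R ω x) y = inner ℂ x (rOmega J R ω y) := by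
  simp only [rOmega, ContinuousLinearMap.comp_apply, add_apply,
    smul_apply, ContinuousLinearMap.id_apply, map_add, map_smul,
    inner_add_left, inner_add_right, inner_smul_left, inner_smul_right, map_mul, conj_I,
    conj_ofReal]
  rw [hR.inner_left, hR.inner_left, hJ.inner_left, anticommute_apply hJR, inner_neg_right]
  ring

theorem norm_rOmega (ω : ℝ) (x : H) : ‖rOmega J R ω x‖ = ‖x‖ := by
  have h : inner ℂ (rOmega J R ω x) (rOmega J R ω x) = inner ℂ x x := by
    rw [inner_rOmega hJ hR hJR, rOmega_rOmega hJ hR hJR]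
  rw [@norm_eq_sqrt_re_inner ℂ, h, ← @norm_eq_sqrt_re_inner ℂ]

theorem cChiOmega_comp_self (χ ω : ℝ) :
    cChiOmega J R χ ω ∘L cChiOmega J R χ ω = ContinuousLinearMap.id ℂ H := by
  have h : (Real.cosh χ : ℂ) ^ 2 - (Real.sinh χ : ℂ) ^ 2 = 1 := by
    exact_mod_cast Real.cosh_sq_sub_sinh_sq χ
  push_cast at h
  ext x
  simp only [cChiOmega, ContinuousLinearMap.comp_apply, add_apply,
    smul_apply, ContinuousLinearMap.id_apply, map_add, map_smul,
    anticommute_rOmega hJR, apply_apply_of_comp_self hJ.2, map_neg, rOmega_rOmega hJ hR hJR]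
  match_scalars
  · linear_combination h
  · ring

omit hJR hR in
theorem J_cChiOmega (χ ω : ℝ) (x : H) : (J ∘L cChiOmega J R χ ω) x =
    (Real.cosh χ : ℂ) • x + (Real.sinh χ : ℂ) • rOmega J R ω x := by
  simp only [cChiOmega, ContinuousLinearMap.comp_apply, add_apply,
    smul_apply, ContinuousLinearMap.id_apply, apply_apply_of_comp_self hJ.2]

/-- J C_{χ,ω} = cosh χ I + sinh χ R_ω, where R_ω is symmetric and norm-preserving; positivity is
|sinh χ| < cosh χ. -/
theorem strictlyPos_cChiOmega (χ ω : ℝ) : StrictlyPos (J ∘L cChiOmega J R χ ω) := by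
  constructor
  · rw [ContinuousLinearMap.isSelfAdjoint_iff_isSymmetric]
    intro x y
    rw [ContinuousLinearMap.coe_coe, J_cChiOmega hJ, J_cChiOmega hJ]
    simp only [inner_add_left, inner_add_right, inner_smul_left, inner_smul_right, conj_ofReal,
      inner_rOmega hJ hR hJR]
  · intro x hx
    rw [J_cChiOmega hJ, inner_add_left, inner_smul_left, inner_smul_left, conj_ofReal,
      conj_ofReal, add_re, re_ofReal_mul, re_ofReal_mul, inner_self_eq_norm_sq_to_K]
    have h1 : |(inner ℂ (rOmega J R ω x) x).re| ≤ ‖x‖ * ‖x‖ := by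
      refine (Complex.abs_re_le_norm _).trans ((norm_inner_le_norm _ _).trans ?_)
      rw [norm_rOmega hJ hR hJR]
    have h2 : |Real.sinh χ| < Real.cosh χ := by
      rw [Real.abs_sinh]
      exact (Real.sinh_lt_cosh _).trans_eq (Real.cosh_abs χ)
    have h3 : 0 < ‖x‖ * ‖x‖ := mul_pos (norm_pos_iff.2 hx) (norm_pos_iff.2 hx)
    have h4 : |Real.sinh χ * (inner ℂ (rOmega J R ω x) x).re| < Real.cosh χ * (‖x‖ * ‖x‖) := by
      rw [abs_mul]
      exact (mul_le_mul_of_nonneg_left h1 (abs_nonneg _)).trans_lt (mul_lt_mul_of_pos_right h2 h3)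
    have h5 : (((‖x‖ : ℂ)) ^ 2).re = ‖x‖ * ‖x‖ := by
      rw [← ofReal_pow, ofReal_re, sq]
    have h6 := (abs_lt.1 h4).1
    change 0 < Real.cosh χ * (((‖x‖ : ℂ)) ^ 2).re + _
    rw [h5]
    linarith

theorem hasCSymmetry_cChiOmega_iff (χ ω : ℝ) : HasCSymmetry J A (cChiOmega J R χ ω) ↔
    GraphInvariant A (cChiOmega J R χ ω) := by
  have h := cChiOmega_comp_self hJ hR hJR χ ω
  rw [HasCSymmetry, commutes_iff_graphInvariant h]
  exact ⟨fun h => h.2.2, fun h' => ⟨h, strictlyPos_cChiOmega hJ hR hJR χ ω, h'⟩⟩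

theorem cChiOmega_mem_cSymmetries (hSJ : GraphInvariant S J) (hSR : GraphInvariant S R)
    (χ ω : ℝ) : cChiOmega J R χ ω ∈ cSymmetries J S :=
  (hasCSymmetry_cChiOmega_iff hJ hR hJR χ ω).2 (hSJ.cChiOmega hSR χ ω)

omit [CompleteSpace H] hJ hJR hR in
theorem cChiOmega_zero (ω : ℝ) : cChiOmega J R 0 ω = J := by
  ext x
  simp [cChiOmega]

-- This shows that commuting with J and one further C_{χ,ω} is enough to commute with R: J C_{1,0} =
-- cosh 1 I + sinh 1 R is solved for R.
omit hR hJR in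
theorem R_eq_of_cChiOmega : R = ((Real.sinh 1 : ℂ)⁻¹) • (J ∘L cChiOmega J R 1 0 +
    (-(Real.cosh 1 : ℂ)) • ContinuousLinearMap.id ℂ H) := by
  have h : (Real.sinh 1 : ℂ) ≠ 0 := by
    exact_mod_cast (Real.sinh_pos_iff.2 one_pos).ne'
  ext x
  have h1 : rOmega J R 0 x = R x := by simp [rOmega]
  rw [smul_apply, add_apply, J_cChiOmega hJ, h1, smul_apply, ContinuousLinearMap.id_apply,
    neg_smul, add_right_comm, add_neg_cancel, zero_add, smul_smul, inv_mul_cancel₀ h, one_smul]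

theorem graphInvariant_of_mem_upsilon (hSJ : GraphInvariant S J) (hSR : GraphInvariant S R)
    (hA : A ∈ upsilon J S) : GraphInvariant A J ∧ GraphInvariant A R := by
  have h : ∀ χ ω, GraphInvariant A (cChiOmega J R χ ω) := fun χ ω =>
    (commutes_iff_graphInvariant (cChiOmega_comp_self hJ hR hJR χ ω)).1
      (hA.2 _ (cChiOmega_mem_cSymmetries hJ hR hJR hSJ hSR χ ω))
  have h1 : GraphInvariant A J := by
    have := h 0 0
    rwa [cChiOmega_zero] at this
  refine ⟨h1, ?_⟩
  rw [R_eq_of_cChiOmega (R := R) hJ]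
  exact ((h1.comp (h 1 0)).add ((GraphInvariant.id A).smul _)).smul _

end

/-! ### Extensions commuting with both fundamental symmetries -/

theorem adjoint_eq_of_isJSelfAdjoint {J : H →L[ℂ] H} (hJ : J ∘L J = ContinuousLinearMap.id ℂ H)
    (hA : IsJSelfAdjoint J A) (hAJ : GraphInvariant A J) : A.adjoint = A := by
  have hJJ := apply_apply_of_comp_self hJ
  rw [isJSelfAdjoint_iff hJ] at hA
  rw [eq_iff_graph]
  intro x y
  constructor
  · intro h
    have h1 := hAJ _ _ ((hA (J x) (J y)).1 (by rwa [hJJ, hJJ]))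
    rwa [hJJ, hJJ] at h1
  · intro h
    have h1 := (hA (J x) (J y)).2 (hAJ _ _ h)
    rwa [hJJ, hJJ] at h1

/-- A self-adjoint extension commuting with `J` and `R` is given by a boundary condition
`a Γ₁ f = c Γ₀ f` with real coefficients. -/
theorem exists_real_boundary_condition {b : OrthonormalBasis (Fin 2) ℂ G} {Jb Rb : G →L[ℂ] G}
    (hb : IsPauliPair b Jb Rb) (hS : IsClosedSymmetric S) (hΓ : IsBoundaryTriplet S Γ₀ Γ₁)
    {J R : H →L[ℂ] H} (hJS : GraphInvariant S.adjoint J) (hRS : GraphInvariant S.adjoint R)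
    (hJ₀ : Intertwines Γ₀ J Jb) (hJ₁ : Intertwines Γ₁ J Jb)
    (hR₀ : Intertwines Γ₀ R Rb) (hR₁ : Intertwines Γ₁ R Rb)
    (hSA : S ≤ A) (hA : A.adjoint = A) (hAJ : GraphInvariant A J) (hAR : GraphInvariant A R) :
    ∃ a c : ℝ, (a ≠ 0 ∨ c ≠ 0) ∧ ∀ f : S.adjoint.domain,
      ((f : H), S.adjoint f) ∈ A.graph ↔ (a : ℂ) • Γ₁ f = (c : ℂ) • Γ₀ f := by
  have hAS : A ≤ S.adjoint := hA ▸ adjoint_le_adjoint hS.1 hSA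
  have hP : ∀ f : S.adjoint.domain, ((f : H), S.adjoint f) ∈ A.graph ↔
      ∀ g : S.adjoint.domain, ((g : H), S.adjoint g) ∈ A.graph →
        inner ℂ (Γ₀ g) (Γ₁ f) = inner ℂ (Γ₁ g) (Γ₀ f) := by
    intro f
    have := hΓ.mem_graph_adjoint_iff hS hSA hAS f
    rwa [hA] at this
  have hPJ : ∀ f : S.adjoint.domain, ((f : H), S.adjoint f) ∈ A.graph →
      ((domainMap S J hJS f : H), S.adjoint (domainMap S J hJS f)) ∈ A.graph := fun f hf => by
    rw [adjoint_domainMap]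
    exact hAJ _ _ hf
  have hPR : ∀ f : S.adjoint.domain, ((f : H), S.adjoint f) ∈ A.graph →
      ((domainMap S R hRS f : H), S.adjoint (domainMap S R hRS f)) ∈ A.graph := fun f hf => by
    rw [adjoint_domainMap]
    exact hAR _ _ hf
  have hPadd : ∀ f g : S.adjoint.domain, ((f : H), S.adjoint f) ∈ A.graph →
      ((g : H), S.adjoint g) ∈ A.graph →
      (((f + g : S.adjoint.domain) : H), S.adjoint (f + g)) ∈ A.graph := fun f g hf hg => by
    rw [LinearPMap.map_add]
    exact A.graph.add_mem hf hg
  have hPsmul : ∀ (t : ℂ) (f : S.adjoint.domain), ((f : H), S.adjoint f) ∈ A.graph →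
      (((t • f : S.adjoint.domain) : H), S.adjoint (t • f)) ∈ A.graph := fun t f hf => by
    rw [LinearPMap.map_smul]
    exact A.graph.smul_mem t hf
  -- an element of `D(A)` with boundary values in the line spanned by the first basis vector
  obtain ⟨f, hf, a, c, hne, hf₀, hf₁⟩ : ∃ f : S.adjoint.domain,
      ((f : H), S.adjoint f) ∈ A.graph ∧ ∃ a c : ℂ, (a ≠ 0 ∨ c ≠ 0) ∧
        Γ₀ f = a • b 0 ∧ Γ₁ f = c • b 0 := by
    obtain ⟨g, hg, hg0⟩ : ∃ g : S.adjoint.domain, ((g : H), S.adjoint g) ∈ A.graph ∧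
        (inner ℂ (b 0) (Γ₀ g) ≠ 0 ∨ inner ℂ (b 0) (Γ₁ g) ≠ 0) := by
      -- Otherwise, since D(A) is invariant under R, which exchanges the two coordinates, all
      -- boundary values on D(A) vanish. Isotropy is then no constraint, and self-adjointness puts
      -- all of D(S*) into D(A).
      by_contra! hcon
      have hz : ∀ g : S.adjoint.domain, ((g : H), S.adjoint g) ∈ A.graph →
          Γ₀ g = 0 ∧ Γ₁ g = 0 := by
        intro g hg
        have h1 := hcon g hg
        have h2 := hcon _ (hPR g hg)
        rw [hR₀.apply_domainMap, hR₁.apply_domainMap, ← hb.inner_Q, ← hb.inner_Q, hb.Q_zero] at h2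
        constructor
        · rw [← b.sum_repr' (Γ₀ g), Fin.sum_univ_two, h1.1, h2.1, zero_smul, zero_smul, add_zero]
        · rw [← b.sum_repr' (Γ₁ g), Fin.sum_univ_two, h1.2, h2.2, zero_smul, zero_smul, add_zero]
      obtain ⟨f, hf, -⟩ := exists_eq_of_surjective_prod hΓ.2 (b 0) 0
      have h1 : ((f : H), S.adjoint f) ∈ A.graph := (hP f).2 fun g hg => by
        rw [(hz g hg).1, (hz g hg).2, inner_zero_left, inner_zero_left]
      have h2 := (hz f h1).1
      rw [hf] at h2
      exact b.orthonormal.ne_zero 0 h2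
    -- I + 𝒥 is twice the projection onto the first basis vector, so g + Jg is the required element.
    have hproj : ∀ x : G, x + Jb x = (2 * inner ℂ (b 0) x) • b 0 := fun x => by
      rw [hb.apply_P]
      nth_rewrite 1 [← b.sum_repr' x]
      rw [Fin.sum_univ_two]
      module
    refine ⟨g + domainMap S J hJS g, hPadd _ _ hg (hPJ g hg), 2 * inner ℂ (b 0) (Γ₀ g),
      2 * inner ℂ (b 0) (Γ₁ g), by simpa using hg0, ?_, ?_⟩
    · rw [map_add, hJ₀.apply_domainMap, hproj]
    · rw [map_add, hJ₁.apply_domainMap, hproj]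
  -- the isotropy condition makes the coefficients proportional to real ones
  have hiso : (starRingEnd ℂ) a * c = (starRingEnd ℂ) c * a := by
    have := (hP f).1 hf f hf
    rw [hf₀, hf₁, inner_smul_left, inner_smul_right, inner_smul_left, inner_smul_right,
      inner_self_eq_norm_sq_to_K, b.orthonormal.1 0] at this
    simpa using this
  obtain ⟨t, a', c', hne', ha', hc'⟩ : ∃ (t : ℂ) (a' c' : ℝ), (a' ≠ 0 ∨ c' ≠ 0) ∧
      t * a = a' ∧ t * c = c' := by
    -- Multiplying by the conjugate of a nonzero coefficient makes both real: by `hiso`, āc is real.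
    by_cases ha : a = 0
    · have hc : c ≠ 0 := by simpa [ha] using hne
      refine ⟨(starRingEnd ℂ) c, 0, normSq c, Or.inr ?_, by simp [ha], ?_⟩
      · simpa using hc
      · rw [mul_comm, mul_conj]
    · have hre : (starRingEnd ℂ) ((starRingEnd ℂ) a * c) = (starRingEnd ℂ) a * c := by
        rw [map_mul, conj_conj, hiso, mul_comm]
      obtain ⟨r, hr⟩ := conj_eq_iff_real.1 hre
      refine ⟨(starRingEnd ℂ) a, normSq a, r, Or.inl ?_, ?_, hr⟩
      · simpa using ha
      · rw [mul_comm, mul_conj]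
  refine ⟨a', c', hne', ?_⟩
  have hfwd : ∀ g : S.adjoint.domain, ((g : H), S.adjoint g) ∈ A.graph →
      (a' : ℂ) • Γ₁ g = (c' : ℂ) • Γ₀ g := by
    intro g hg
    -- Testing g against tf and R(tf), with boundary values (a'e, c'e) for e = b 0 and e = b 1,
    -- gives the boundary condition coordinate by coordinate.
    have hcoord : ∀ h : S.adjoint.domain, ∀ e : G, Γ₀ h = (a' : ℂ) • e → Γ₁ h = (c' : ℂ) • e →
        ((h : H), S.adjoint h) ∈ A.graph →
        inner ℂ e ((a' : ℂ) • Γ₁ g) = inner ℂ e ((c' : ℂ) • Γ₀ g) := by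
      intro h e h0 h1 hh
      have := (hP g).1 hg h hh
      rw [h0, h1, inner_smul_left, inner_smul_left, conj_ofReal, conj_ofReal] at this
      rw [inner_smul_right, inner_smul_right, this]
    have e0 := hcoord (t • f) (b 0) (by rw [map_smul, hf₀, smul_smul, ha'])
      (by rw [map_smul, hf₁, smul_smul, hc']) (hPsmul t f hf)
    have e1 := hcoord (domainMap S R hRS (t • f)) (b 1)
      (by rw [hR₀.apply_domainMap, map_smul, hf₀, smul_smul, ha', map_smul, hb.Q_zero])
      (by rw [hR₁.apply_domainMap, map_smul, hf₁, smul_smul, hc', map_smul, hb.Q_zero])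
      (hPR _ (hPsmul t f hf))
    rw [← b.sum_repr' ((a' : ℂ) • Γ₁ g), Fin.sum_univ_two, e0, e1, ← Fin.sum_univ_two
      (f := fun i => inner ℂ (b i) ((c' : ℂ) • Γ₀ g) • b i), b.sum_repr']
  refine fun g => ⟨hfwd g, fun hg => (hP g).2 fun h hh => ?_⟩
  have h1 := hfwd h hh
  rcases hne' with ha | hc
  · have ha : (a' : ℂ) ≠ 0 := by exact_mod_cast ha
    apply mul_left_cancel₀ ha
    rw [← inner_smul_right, hg, inner_smul_right, ← conj_ofReal a', ← inner_smul_left, h1,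
      inner_smul_left, conj_ofReal]
  · have hc : (c' : ℂ) ≠ 0 := by exact_mod_cast hc
    apply mul_left_cancel₀ hc
    rw [← inner_smul_right (Γ₁ h) (Γ₀ g) (c' : ℂ), ← hg, inner_smul_right, ← conj_ofReal c',
      ← inner_smul_left, ← h1, inner_smul_left, conj_ofReal]

/-- Real symplectic changes of a boundary triplet. -/
theorem IsBoundaryTriplet.linear_comb (hΓ : IsBoundaryTriplet S Γ₀ Γ₁) {p q r s : ℝ}
    (hdet : p * s - q * r = 1) :
    IsBoundaryTriplet S ((p : ℂ) • Γ₀ + (q : ℂ) • Γ₁) ((r : ℂ) • Γ₀ + (s : ℂ) • Γ₁) := by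
  have hdet' : (p : ℂ) * s - q * r = 1 := by exact_mod_cast hdet
  constructor
  · intro x y
    rw [hΓ.1]
    simp only [LinearMap.add_apply, LinearMap.smul_apply, inner_add_left, inner_add_right,
      inner_smul_left, inner_smul_right, conj_ofReal]
    linear_combination (inner ℂ (Γ₁ y) (Γ₀ x) - inner ℂ (Γ₀ y) (Γ₁ x)) * hdet'
  · rintro ⟨u, v⟩
    obtain ⟨f, h0, h1⟩ := exists_eq_of_surjective_prod hΓ.2 ((s : ℂ) • u - (q : ℂ) • v)
      ((p : ℂ) • v - (r : ℂ) • u)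
    refine ⟨f, Prod.ext ?_ ?_⟩
    · change (p : ℂ) • Γ₀ f + (q : ℂ) • Γ₁ f = u
      rw [h0, h1]
      match_scalars
      · linear_combination hdet'
      · ring
    · change (r : ℂ) • Γ₀ f + (s : ℂ) • Γ₁ f = v
      rw [h0, h1]
      match_scalars
      · ring
      · linear_combination hdet'

/-- If `S` has an extension in `Υ`, then every `C`-symmetry of `S` acts on the boundary values
through a `C`-symmetry of the boundary space. -/
theorem exists_boundary_cSymmetry_of_upsilon {b : OrthonormalBasis (Fin 2) ℂ G}
    {Jb Rb : G →L[ℂ] G}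
    (hb : IsPauliPair b Jb Rb) (hS : IsClosedSymmetric S) (hΓ : IsBoundaryTriplet S Γ₀ Γ₁)
    (hd : Module.finrank ℂ (defectSubspace S I) = 2) {J R : H →L[ℂ] H}
    (hJ : IsFundamentalSymmetry J) (hR : IsFundamentalSymmetry R) (hJR : J ∘L R + R ∘L J = 0)
    (hSJ : GraphInvariant S J) (hSR : GraphInvariant S R)
    (hJ₀ : Intertwines Γ₀ J Jb) (hJ₁ : Intertwines Γ₁ J Jb)
    (hR₀ : Intertwines Γ₀ R Rb) (hR₁ : Intertwines Γ₁ R Rb)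
    (hΥ : (upsilon J S).Nonempty)
    {C : H →L[ℂ] H} (hC : C ∈ cSymmetries J S) (hCS : GraphInvariant S.adjoint C) :
    ∃ C₀ : G →ₗ[ℂ] G, (∀ x, C₀ (C₀ x) = x) ∧
      (∀ x y, inner ℂ (Jb (C₀ x)) y = inner ℂ x (Jb (C₀ y))) ∧
      (∀ x, x ≠ 0 → 0 < (inner ℂ (Jb (C₀ x)) x).re) ∧
      (∀ f, Γ₀ (domainMap S C hCS f) = C₀ (Γ₀ f)) ∧
      (∀ f, Γ₁ (domainMap S C hCS f) = C₀ (Γ₁ f)) := by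
  obtain ⟨A, hA⟩ := hΥ
  have hJS := hSJ.adjoint hS.1 hJ.inner_left
  have hRS := hSR.adjoint hS.1 hR.inner_left
  obtain ⟨hAJ, hAR⟩ := graphInvariant_of_mem_upsilon hJ hR hJR hSJ hSR hA
  have hAC : GraphInvariant A C := (commutes_iff_graphInvariant hC.1).1 (hA.2 C hC)
  obtain ⟨a, c, hne, hac⟩ := exists_real_boundary_condition hb hS hΓ hJS hRS hJ₀ hJ₁ hR₀ hR₁
    hA.1.1 (adjoint_eq_of_isJSelfAdjoint hJ.2 hA.1.2 hAJ) hAJ hAR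
  -- The new Γ₀ is -cΓ₀ + aΓ₁, whose kernel is D(A); p and q complete (-c, a) to a real matrix of
  -- determinant 1.
  obtain ⟨p, q, hdet⟩ : ∃ p q : ℝ, -c * q - a * p = 1 := by
    have hn : a ^ 2 + c ^ 2 ≠ 0 := by
      rcases hne with h | h <;> positivity
    refine ⟨-a / (a ^ 2 + c ^ 2), -c / (a ^ 2 + c ^ 2), ?_⟩
    field_simp
    ring
  have hdet' : -(c : ℂ) * q - a * p = 1 := by exact_mod_cast hdet
  obtain ⟨C₀, h1, h2, h3, h4, h5⟩ := exists_boundary_cSymmetry hb (hΓ.linear_comb hdet) hd hJ hR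
    hJS hRS (hJ₀.linear_comb _ _ hJ₁) (hJ₀.linear_comb _ _ hJ₁) (hR₀.linear_comb _ _ hR₁)
    (hR₀.linear_comb _ _ hR₁) hCS hC.1 hC.2.1 (fun f hf => by
      have hiff : ∀ g : S.adjoint.domain,
          (((-c : ℝ) : ℂ) • Γ₀ + (a : ℂ) • Γ₁) g = 0 ↔ ((g : H), S.adjoint g) ∈ A.graph := by
        intro g
        rw [hac, LinearMap.add_apply, LinearMap.smul_apply, LinearMap.smul_apply, ofReal_neg,
          neg_smul, neg_add_eq_zero, eq_comm]
      rw [hiff] at hf ⊢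
      rw [adjoint_domainMap]
      exact hAC _ _ hf)
  refine ⟨C₀, h1, h2, h3, fun f => ?_, fun f => ?_⟩
  · have e : ∀ g, Γ₀ g = (q : ℂ) • (((-c : ℝ) : ℂ) • Γ₀ + (a : ℂ) • Γ₁) g -
        (a : ℂ) • ((p : ℂ) • Γ₀ + (q : ℂ) • Γ₁) g := fun g => by
      simp only [LinearMap.add_apply, LinearMap.smul_apply, ofReal_neg]
      match_scalars
      · linear_combination -hdet'
      · ring
    rw [e, h4, h5, e f, map_sub, map_smul, map_smul]
  · have e : ∀ g, Γ₁ g = (-(p : ℂ)) • (((-c : ℝ) : ℂ) • Γ₀ + (a : ℂ) • Γ₁) g +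
        (-(c : ℂ)) • ((p : ℂ) • Γ₀ + (q : ℂ) • Γ₁) g := fun g => by
      simp only [LinearMap.add_apply, LinearMap.smul_apply, ofReal_neg]
      match_scalars
      · linear_combination -hdet'
      · ring
    rw [e, h4, h5, e f, map_add, map_smul, map_smul]

end

section


open scoped ComplexConjugate

/-! ### The matrices `K(ζ, φ, ξ, ω)` and `C_{χ,ω}` -/

theorem conj_exp_neg_I_mul (t : ℝ) : conj (exp (-(I * t))) = exp (I * t) := by
  rw [← exp_conj, map_neg, map_mul, conj_I, conj_ofReal, neg_mul, neg_neg]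

theorem exp_mul_exp_neg_I_mul (t : ℝ) : exp (I * t) * exp (-(I * t)) = 1 := by
  rw [← exp_add, add_neg_cancel, exp_zero]

theorem exp_add_exp_neg_I_mul (t : ℝ) :
    exp (I * t) + exp (-(I * t)) = 2 * (Real.cos t : ℂ) := by
  rw [ofReal_cos, two_cos, mul_comm I, neg_mul]

theorem norm_exp_neg_I_mul (t : ℝ) : ‖exp (-(I * t))‖ = 1 := by
  rw [mul_comm, ← neg_mul, ← ofReal_neg, norm_exp_ofReal_mul_I]

theorem exists_exp_neg_I_mul_eq {z : ℂ} (hz : ‖z‖ = 1) :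
    ∃ t ∈ Set.Ico (0 : ℝ) (2 * Real.pi), exp (-(I * t)) = z := by
  have h : exp (arg z * I) = z := by
    have := norm_mul_exp_arg_mul_I z
    rwa [hz, ofReal_one, one_mul] at this
  have h1 := neg_pi_lt_arg z
  have h2 := arg_le_pi z
  rcases le_or_gt (arg z) 0 with h0 | h0
  · refine ⟨-arg z, ⟨by linarith, by linarith⟩, ?_⟩
    rw [← h]
    congr 1
    push_cast
    rw [h]
    ring
  · refine ⟨2 * Real.pi - arg z, ⟨by linarith, by linarith⟩, ?_⟩
    have : -(I * ((2 * Real.pi - arg z : ℝ) : ℂ)) = arg z * I - 2 * Real.pi * I := by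
      push_cast
      ring
    rw [this, exp_sub, exp_two_pi_mul_I, div_one, h]

/-- The relations between the entries of a matrix which is unitary for `diag(1, -1)`. -/
structure IsJUnitaryMatrix (M : Matrix (Fin 2) (Fin 2) ℂ) : Prop where
  col_zero : conj (M 0 0) * M 0 0 - conj (M 1 0) * M 1 0 = 1
  col_one : conj (M 1 1) * M 1 1 - conj (M 0 1) * M 0 1 = 1
  cross : conj (M 0 0) * M 0 1 = conj (M 1 0) * M 1 1

theorem isJUnitaryMatrix_kMatrix (ζ φ ξ ω : ℝ) : IsJUnitaryMatrix (kMatrix ζ φ ξ ω) := by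
  have hc : (Real.cosh ζ : ℂ) ^ 2 - (Real.sinh ζ : ℂ) ^ 2 = 1 := by
    exact_mod_cast Real.cosh_sq_sub_sinh_sq ζ
  have h1 := exp_mul_exp_neg_I_mul ξ
  have h2 := exp_mul_exp_neg_I_mul φ
  have h3 := exp_mul_exp_neg_I_mul ω
  have e : ∀ t : ℝ, conj (exp (I * t)) = exp (-(I * t)) := fun t => by
    rw [← conj_exp_neg_I_mul, conj_conj]
  constructor <;>
  simp only [kMatrix, Matrix.smul_apply, Matrix.of_apply, Matrix.cons_val', Matrix.cons_val_zero,
    Matrix.cons_val_one, Matrix.cons_val_fin_one, smul_eq_mul, map_mul, map_neg,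
    conj_exp_neg_I_mul, e, conj_ofReal]
  all_goals
    generalize exp (I * ξ) = u' at *
    generalize exp (-(I * ξ)) = u at *
    generalize exp (I * φ) = v' at *
    generalize exp (-(I * φ)) = v at *
    generalize exp (I * ω) = w' at *
    generalize exp (-(I * ω)) = w at *
    generalize (Real.cosh ζ : ℂ) = c at *
    generalize (Real.sinh ζ : ℂ) = s at *
  · linear_combination hc + (v' * v * c ^ 2 - w' * w * s ^ 2) * h1 + c ^ 2 * h2 - s ^ 2 * h3
  · linear_combination hc + (v' * v * c ^ 2 - w' * w * s ^ 2) * h1 + c ^ 2 * h2 - s ^ 2 * h3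
  · ring

/-- The column relations give |p| = |s| = cosh ζ and |q| = sinh ζ. The phases of p, s and q then
determine φ, ξ and ω, while r is forced by the cross relation. -/
theorem IsJUnitaryMatrix.exists_eq_kMatrix {M : Matrix (Fin 2) (Fin 2) ℂ}
    (h : IsJUnitaryMatrix M) :
    ∃ ζ : ℝ, ∃ φ ∈ Set.Icc (0 : ℝ) Real.pi, ∃ ξ ∈ Set.Ico (0 : ℝ) (2 * Real.pi),
      ∃ ω ∈ Set.Ico (0 : ℝ) (2 * Real.pi), M = kMatrix ζ φ ξ ω := by
  obtain ⟨h0, h1, h2⟩ := h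
  obtain ⟨p, hp⟩ : ∃ p, p = M 0 0 := ⟨_, rfl⟩
  obtain ⟨q, hq⟩ : ∃ q, q = M 0 1 := ⟨_, rfl⟩
  obtain ⟨r, hr⟩ : ∃ r, r = M 1 0 := ⟨_, rfl⟩
  obtain ⟨s, hs⟩ : ∃ s, s = M 1 1 := ⟨_, rfl⟩
  rw [← hp, ← hr] at h0
  rw [← hq, ← hs] at h1
  rw [← hp, ← hq, ← hr, ← hs] at h2
  rw [conj_mul', conj_mul'] at h0 h1
  have h0' : ‖p‖ ^ 2 - ‖r‖ ^ 2 = 1 := by exact_mod_cast h0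
  have h1' : ‖s‖ ^ 2 - ‖q‖ ^ 2 = 1 := by exact_mod_cast h1
  have h2' : ‖p‖ * ‖q‖ = ‖r‖ * ‖s‖ := by
    have := congrArg norm h2
    rwa [norm_mul, norm_mul, norm_conj, norm_conj] at this
  have hps : ‖p‖ = ‖s‖ := by
    have h3 : ‖p‖ ^ 2 = ‖s‖ ^ 2 := by
      linear_combination ‖s‖ ^ 2 * h0' - ‖p‖ ^ 2 * h1' - (‖p‖ * ‖q‖ + ‖r‖ * ‖s‖) * h2'
    exact (sq_eq_sq₀ (norm_nonneg _) (norm_nonneg _)).1 h3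
  have hcosh : Real.cosh (Real.arsinh ‖q‖) = ‖s‖ := by
    rw [Real.cosh_arsinh, Real.sqrt_eq_iff_mul_self_eq (by positivity) (norm_nonneg _)]
    linarith
  have hsinh : Real.sinh (Real.arsinh ‖q‖) = ‖q‖ := Real.sinh_arsinh _
  have hs0 : ‖s‖ ≠ 0 := by
    intro h
    rw [h] at h1'
    nlinarith [norm_nonneg q]
  have hs0' : s ≠ 0 := norm_ne_zero_iff.1 hs0
  have hs0'' : (‖s‖ : ℂ) ≠ 0 := by exact_mod_cast hs0
  -- The quotient -p/s must equal e^{-2iφ}. Thus φ = t/2, and t in [0, 2π) puts φ into [0, π].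
  obtain ⟨t, ht, hz⟩ := exists_exp_neg_I_mul_eq (z := -p / s) (by
    rw [norm_div, norm_neg, hps, div_self hs0])
  obtain ⟨ξ, hξ, hu⟩ := exists_exp_neg_I_mul_eq (z := s * exp (-(I * (t / 2 : ℝ))) / ‖s‖) (by
    rw [norm_div, norm_mul, norm_exp_neg_I_mul, norm_real, norm_norm, mul_one, div_self hs0])
  obtain ⟨ω, hω, hw⟩ : ∃ ω ∈ Set.Ico (0 : ℝ) (2 * Real.pi),
      exp (-(I * ξ)) * exp (-(I * ω)) * ‖q‖ = q := by
    -- If q = 0 then sinh ζ = 0, so ω plays no role and is set to 0.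
    by_cases hq0 : q = 0
    · exact ⟨0, ⟨le_rfl, by positivity⟩, by simp [hq0]⟩
    · have hq0' : (‖q‖ : ℂ) ≠ 0 := by exact_mod_cast norm_ne_zero_iff.2 hq0
      obtain ⟨ω, hω, hw⟩ := exists_exp_neg_I_mul_eq (z := q / ‖q‖ * exp (I * ξ)) (by
        rw [norm_mul, norm_div, norm_real, norm_norm, div_self (norm_ne_zero_iff.2 hq0),
          ← conj_exp_neg_I_mul, norm_conj, norm_exp_neg_I_mul, mul_one])
      refine ⟨ω, hω, ?_⟩
      rw [hw]
      field_simp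
      rw [mul_comm, exp_mul_exp_neg_I_mul]
  refine ⟨Real.arsinh ‖q‖, t / 2, ⟨by linarith [ht.1], by linarith [ht.2]⟩, ξ, hξ, ω, hω, ?_⟩
  have hv : exp (-(I * (t / 2 : ℝ))) * exp (-(I * (t / 2 : ℝ))) = -p / s := by
    rw [← hz, ← exp_add]
    congr 1
    push_cast
    ring
  have hv1 := exp_mul_exp_neg_I_mul (t / 2)
  have hu1 := exp_mul_exp_neg_I_mul ξ
  have hS : exp (-(I * ξ)) * (exp (I * (t / 2 : ℝ)) * ‖s‖) = s := by
    rw [hu]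
    field_simp
    linear_combination hv1
  have hP : exp (-(I * ξ)) * (-exp (-(I * (t / 2 : ℝ))) * ‖s‖) = p := by
    have h3 : s * (exp (-(I * (t / 2 : ℝ))) * exp (-(I * (t / 2 : ℝ)))) = -p := by
      rw [hv]
      field_simp
    rw [hu]
    field_simp
    linear_combination -h3
  have hR : exp (-(I * ξ)) * (-exp (I * ω) * ‖q‖) = r := by
    have h3 : conj r = -(exp (I * ξ) * exp (-(I * ω)) * ‖q‖) := by
      apply mul_right_cancel₀ hs0'
      rw [← h2]
      calc conj p * q = conj (exp (-(I * ξ)) * (-exp (-(I * (t / 2 : ℝ))) * ‖s‖)) *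
            (exp (-(I * ξ)) * exp (-(I * ω)) * ‖q‖) := by rw [hP, hw]
        _ = -(exp (I * ξ) * exp (-(I * ω)) * ‖q‖) *
            (exp (-(I * ξ)) * (exp (I * (t / 2 : ℝ)) * ‖s‖)) := by
          simp only [map_mul, map_neg, conj_exp_neg_I_mul, conj_ofReal]
          ring
        _ = _ := by rw [hS]
    have h4 := congrArg conj h3
    rw [conj_conj] at h4
    rw [h4, ← conj_exp_neg_I_mul, ← conj_exp_neg_I_mul]
    simp only [map_mul, map_neg, conj_conj, conj_ofReal]
    ring
  ext i j
  fin_cases i <;> fin_cases j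
  · simpa [kMatrix, hcosh, ← hp, -ofReal_cosh, -ofReal_div] using hP.symm
  · simpa [kMatrix, hsinh, ← hq, -ofReal_sinh, -ofReal_div, mul_assoc] using hw.symm
  · simpa [kMatrix, hsinh, ← hr, -ofReal_sinh, -ofReal_div] using hR.symm
  · simpa [kMatrix, hcosh, ← hs, -ofReal_cosh, -ofReal_div] using hS.symm

/-! ### Special values of K and the matrices commuting with it -/

theorem kMatrix_zero (φ ξ ω : ℝ) : kMatrix 0 φ ξ ω =
    exp (-(I * ξ)) • !![-exp (-(I * φ)), 0; 0, exp (I * φ)] := by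
  simp [kMatrix]

theorem kMatrix_zero_pi_div_two (ξ ω : ℝ) : kMatrix 0 (Real.pi / 2) ξ ω =
    !![I * exp (-(I * ξ)), 0; 0, I * exp (-(I * ξ))] := by
  have h : exp (I * ((Real.pi / 2 : ℝ) : ℂ)) = I := by
    rw [mul_comm]
    push_cast
    exact exp_pi_div_two_mul_I
  have h' : exp (-(I * ((Real.pi / 2 : ℝ) : ℂ))) = -I := by
    rw [exp_neg, h, inv_I]
  rw [kMatrix_zero, h, h']
  simp [mul_comm]

theorem kMatrix_neg (ζ φ ξ ω : ℝ) : kMatrix (-ζ) φ ξ ω =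
    !![1, 0; 0, -1] * kMatrix ζ φ ξ ω * !![1, 0; 0, -1] := by
  ext i j
  fin_cases i <;> fin_cases j <;> simp [kMatrix]

/-- The matrix of `C_{χ,ω}` in the boundary space. -/
def cMatrix (χ ω : ℝ) : Matrix (Fin 2) (Fin 2) ℂ :=
  !![(Real.cosh χ : ℂ), exp (-(I * ω)) * (Real.sinh χ : ℂ);
    -exp (I * ω) * (Real.sinh χ : ℂ), -(Real.cosh χ : ℂ)]

theorem kMatrix_mul_cMatrix {ζ φ χ : ℝ} (ξ ω : ℝ)
    (h : Real.cos φ * Real.tanh χ = -Real.tanh ζ) :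
    kMatrix ζ φ ξ ω * cMatrix χ ω = cMatrix χ ω * kMatrix ζ φ ξ ω := by
  -- The relation for χ without denominators is precisely what the off-diagonal entries of the
  -- commutator require; the diagonal entries agree identically.
  have h1 : (Real.cos φ : ℂ) * Real.sinh χ * Real.cosh ζ = -(Real.sinh ζ * Real.cosh χ) := by
    rw [Real.tanh_eq_sinh_div_cosh, Real.tanh_eq_sinh_div_cosh] at h
    have h2 := (Real.cosh_pos χ).ne'
    have h3 := (Real.cosh_pos ζ).ne'
    field_simp at h
    have h4 : Real.cos φ * Real.sinh χ * Real.cosh ζ = -(Real.sinh ζ * Real.cosh χ) := by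
      linarith
    exact_mod_cast h4
  have h2 := exp_add_exp_neg_I_mul φ
  ext i j
  fin_cases i <;> fin_cases j <;>
  simp only [kMatrix, cMatrix, Matrix.mul_apply, Fin.sum_univ_two, Matrix.smul_apply,
    Matrix.of_apply, Matrix.cons_val', Matrix.cons_val_zero, Matrix.cons_val_one,
    Matrix.cons_val_fin_one, smul_eq_mul, Fin.zero_eta, Fin.mk_one]
  all_goals
    generalize exp (I * φ) = v' at *
    generalize exp (-(I * φ)) = v at *
    generalize exp (-(I * ξ)) = u at *
    generalize exp (I * ω) = w' at *
    generalize exp (-(I * ω)) = w at *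
  · ring
  · linear_combination -u * w * Real.sinh χ * Real.cosh ζ * h2 - 2 * u * w * h1
  · linear_combination -u * w' * Real.sinh χ * Real.cosh ζ * h2 - 2 * u * w' * h1
  · ring

theorem eq_pi_div_two_of_cos_eq_zero {φ : ℝ} (hφ : φ ∈ Set.Icc (0 : ℝ) Real.pi)
    (h : Real.cos φ = 0) : φ = Real.pi / 2 := by
  apply Real.injOn_cos hφ ⟨by positivity, by linarith [Real.pi_pos]⟩
  rw [h, Real.cos_pi_div_two]

/-- This is the (0, 1) entry of the commutation relation, with e^{-iξ} cancelled and the two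
exponentials in φ combined into 2 cos φ. -/
theorem cos_mul_eq_of_commute {ζ φ ξ ω : ℝ} {M : Matrix (Fin 2) (Fin 2) ℂ}
    (h : kMatrix ζ φ ξ ω * M = M * kMatrix ζ φ ξ ω) :
    -(2 * Real.cos φ * Real.cosh ζ * M 0 1) =
      (M 0 0 - M 1 1) * (exp (-(I * ω)) * Real.sinh ζ) := by
  have h1 := congrFun (congrFun h 0) 1
  have h2 := exp_add_exp_neg_I_mul φ
  have hu : exp (-(I * ξ)) ≠ 0 := exp_ne_zero _
  simp only [kMatrix, Matrix.mul_apply, Fin.sum_univ_two, Matrix.smul_apply,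
    Matrix.of_apply, Matrix.cons_val', Matrix.cons_val_zero, Matrix.cons_val_one,
    Matrix.cons_val_fin_one, smul_eq_mul] at h1
  apply mul_left_cancel₀ hu
  linear_combination h1 + exp (-(I * ξ)) * Real.cosh ζ * M 0 1 * h2

theorem existsUnique_tanh {ζ φ : ℝ} (h : |Real.tanh ζ| < |Real.cos φ|) :
    ∃! χ : ℝ, Real.cos φ * Real.tanh χ = -Real.tanh ζ := by
  have hc : Real.cos φ ≠ 0 := abs_pos.1 ((abs_nonneg _).trans_lt h)
  have ht : -Real.tanh ζ / Real.cos φ ∈ Set.Ioo (-1 : ℝ) 1 := by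
    rw [Set.mem_Ioo, ← abs_lt, abs_div, abs_neg, div_lt_one (abs_pos.2 hc)]
    exact h
  refine ⟨Real.artanh (-Real.tanh ζ / Real.cos φ), ?_, fun χ hχ => ?_⟩
  · dsimp only
    rw [Real.tanh_artanh ht]
    field_simp
  · apply Real.tanh_injective
    rw [Real.tanh_artanh ht, ← hχ]
    field_simp

theorem abs_tanh_lt_of_boundary_cSymmetry {ζ φ ξ ω : ℝ} (hφ : φ ∈ Set.Icc (0 : ℝ) Real.pi)
    {M : Matrix (Fin 2) (Fin 2) ℂ} (h : kMatrix ζ φ ξ ω * M = M * kMatrix ζ φ ξ ω)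
    (hM : M * M = 1) (h00 : conj (M 0 0) = M 0 0) (h11 : conj (M 1 1) = M 1 1)
    (h10 : M 1 0 = -conj (M 0 1)) (hp : 0 < (M 0 0).re) (hn : (M 1 1).re < 0) :
    |Real.tanh ζ| < |Real.cos φ| ∨ (ζ = 0 ∧ φ = Real.pi / 2) := by
  have hk := cos_mul_eq_of_commute h
  have e0 := congrFun (congrFun hM 0) 0
  have e1 := congrFun (congrFun hM 1) 1
  simp only [Matrix.mul_apply, Fin.sum_univ_two, Matrix.one_apply_eq, h10] at e0 e1
  obtain ⟨a, ha⟩ := conj_eq_iff_real.1 h00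
  obtain ⟨d, hd⟩ := conj_eq_iff_real.1 h11
  rw [ha, mul_neg, mul_conj] at e0
  rw [hd, neg_mul, mul_comm (conj _), mul_conj] at e1
  rw [ha, hd] at hk
  rw [ha, ofReal_re] at hp
  rw [hd, ofReal_re] at hn
  have e0' : a * a - normSq (M 0 1) = 1 := by
    have : ((a * a + -normSq (M 0 1) : ℝ) : ℂ) = 1 := by exact_mod_cast e0
    have : a * a + -normSq (M 0 1) = 1 := by exact_mod_cast this
    linarith
  have e1' : d * d - normSq (M 0 1) = 1 := by
    have : ((-normSq (M 0 1) + d * d : ℝ) : ℂ) = 1 := by exact_mod_cast e1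
    have : -normSq (M 0 1) + d * d = 1 := by exact_mod_cast this
    linarith
  -- Both squares equal 1 + |M 0 1|², and the signs of a and d differ.
  have had : d = -a := by
    have : (a - d) * (a + d) = 0 := by linear_combination e0' - e1'
    rcases mul_eq_zero.1 this with h | h <;> linarith
  subst had
  have hnorm := congrArg norm hk
  have hca := Real.cosh_pos ζ
  rw [norm_neg, norm_mul, norm_mul, norm_mul, norm_mul, norm_mul, norm_exp_neg_I_mul, one_mul,
    ← ofReal_sub, norm_real, norm_real, norm_real, norm_real, Real.norm_eq_abs, Real.norm_eq_abs,
    Real.norm_eq_abs, Real.norm_eq_abs, abs_of_pos hca, abs_of_pos (by linarith : 0 < a - -a),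
    RCLike.norm_ofNat] at hnorm
  -- From a² = 1 + |M 0 1|². This strict gap is the source of the strict inequality between |tanh ζ|
  -- and |cos φ|.
  have hlt : ‖M 0 1‖ < a := by
    have : ‖M 0 1‖ ^ 2 < a ^ 2 := by
      rw [← normSq_eq_norm_sq]
      linarith
    exact lt_of_pow_lt_pow_left₀ 2 hp.le this
  by_cases hc : Real.cos φ = 0
  · right
    rw [hc, abs_zero, mul_zero, zero_mul, zero_mul, eq_comm, mul_eq_zero] at hnorm
    rcases hnorm with h | h
    · linarith
    · exact ⟨Real.sinh_eq_zero.1 (abs_eq_zero.1 h), eq_pi_div_two_of_cos_eq_zero hφ hc⟩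
  · left
    rw [Real.tanh_eq_sinh_div_cosh, abs_div, abs_of_pos hca, div_lt_iff₀ hca]
    have hpos : 0 < |Real.cos φ| * Real.cosh ζ := mul_pos (abs_pos.2 hc) hca
    have := mul_lt_mul_of_pos_left hlt hpos
    refine lt_of_mul_lt_mul_left (a := a) ?_ hp.le
    linarith

end

section


open scoped ComplexConjugate

variable {H : Type*} [NormedAddCommGroup H] [InnerProductSpace ℂ H] [CompleteSpace H]
variable {G : Type*} [NormedAddCommGroup G] [InnerProductSpace ℂ G]
variable {S : H →ₗ.[ℂ] H} {Γ₀ Γ₁ : S.adjoint.domain →ₗ[ℂ] G}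

/-! ### Operators on the boundary space as matrices -/

section

variable (b : OrthonormalBasis (Fin 2) ℂ G)

theorem inner_ofMatrix (M : Matrix (Fin 2) (Fin 2) ℂ) (i : Fin 2) (x : G) :
    inner ℂ (b i) (ofMatrix b M x) = M i 0 * inner ℂ (b 0) x + M i 1 * inner ℂ (b 1) x := by
  rw [ofMatrix, ← b.repr_apply_apply, ← b.coe_toBasis_repr_apply, Matrix.toLin_apply]
  simp only [map_sum, map_smul, Finsupp.coe_finsetSum, Finset.sum_apply, Finsupp.smul_apply,
    Module.Basis.repr_self, smul_eq_mul]
  rw [Finset.sum_eq_single i (fun j _ hj => by rw [Finsupp.single_eq_of_ne hj.symm, mul_zero])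
    (fun h => absurd (Finset.mem_univ i) h), Finsupp.single_eq_same, mul_one, Matrix.mulVec,
    dotProduct, Fin.sum_univ_two, b.coe_toBasis_repr_apply, b.coe_toBasis_repr_apply,
    b.repr_apply_apply, b.repr_apply_apply]

theorem ofMatrix_apply_basis (M : Matrix (Fin 2) (Fin 2) ℂ) (j : Fin 2) :
    ofMatrix b M (b j) = M 0 j • b 0 + M 1 j • b 1 := by
  have := Matrix.toLin_self b.toBasis b.toBasis M j
  rwa [Fin.sum_univ_two, b.coe_toBasis] at this

theorem ofMatrix_mul (M N : Matrix (Fin 2) (Fin 2) ℂ) :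
    ofMatrix b (M * N) = ofMatrix b M ∘ₗ ofMatrix b N :=
  Matrix.toLin_mul _ _ _ _ _

theorem ofMatrix_one : ofMatrix b 1 = LinearMap.id :=
  Matrix.toLin_one _

theorem ofMatrix_injective : Function.Injective (ofMatrix b) :=
  (Matrix.toLin b.toBasis b.toBasis).injective

theorem exists_eq_ofMatrix (K : G →ₗ[ℂ] G) : ∃ M, K = ofMatrix b M :=
  ⟨LinearMap.toMatrix b.toBasis b.toBasis K, (Matrix.toLin_toMatrix _ _ K).symm⟩

theorem ofMatrix_comm_iff {M N : Matrix (Fin 2) (Fin 2) ℂ} :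
    ofMatrix b M ∘ₗ ofMatrix b N = ofMatrix b N ∘ₗ ofMatrix b M ↔ M * N = N * M := by
  rw [← ofMatrix_mul, ← ofMatrix_mul, (ofMatrix_injective b).eq_iff]

theorem inner_eq_coord (x y : G) : inner ℂ x y =
    conj (inner ℂ (b 0) x) * inner ℂ (b 0) y + conj (inner ℂ (b 1) x) * inner ℂ (b 1) y := by
  rw [← b.sum_inner_mul_inner, Fin.sum_univ_two, inner_conj_symm, inner_conj_symm]

theorem isPauliPair_of_matrix {P Q : G →L[ℂ] G}
    (hP : (P : G →ₗ[ℂ] G) = ofMatrix b !![1, 0; 0, -1])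
    (hQ : (Q : G →ₗ[ℂ] G) = ofMatrix b !![0, 1; 1, 0]) : IsPauliPair b P Q := by
  constructor <;> rw [← ContinuousLinearMap.coe_coe] <;> first
  | rw [hP, ofMatrix_apply_basis]
    simp
  | rw [hQ, ofMatrix_apply_basis]
    simp

end

theorem inner_basis_zero_one (b : OrthonormalBasis (Fin 2) ℂ G) :
    inner ℂ (b 0) (b 0) = (1 : ℂ) ∧ inner ℂ (b 1) (b 1) = (1 : ℂ) ∧
      inner ℂ (b 0) (b 1) = (0 : ℂ) ∧ inner ℂ (b 1) (b 0) = (0 : ℂ) := by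
  simp [b.inner_eq_ite]

section

variable {b : OrthonormalBasis (Fin 2) ℂ G} {Jb Rb : G →L[ℂ] G}

theorem IsPauliPair.inner_zero_P (hb : IsPauliPair b Jb Rb) (x : G) :
    inner ℂ (b 0) (Jb x) = inner ℂ (b 0) x := by
  rw [← hb.inner_P, hb.P_zero]

theorem IsPauliPair.inner_one_P (hb : IsPauliPair b Jb Rb) (x : G) :
    inner ℂ (b 1) (Jb x) = -inner ℂ (b 1) x := by
  rw [← hb.inner_P, hb.P_one, inner_neg_left]

theorem IsJUnitary.injective (hb : IsPauliPair b Jb Rb) {K : G →ₗ[ℂ] G}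
    (hK : ∀ x y : G, inner ℂ (K y) (Jb (K x)) = inner ℂ y (Jb x)) : Function.Injective K := by
  rw [injective_iff_map_eq_zero]
  intro x hx
  have h : Jb x = 0 := ext_inner_left ℂ fun y => by
    rw [← hK, hx, map_zero, inner_zero_right, inner_zero_right]
  rw [← hb.P_P x, h, map_zero]

theorem isJUnitary_ofMatrix_iff (hb : IsPauliPair b Jb Rb) {M : Matrix (Fin 2) (Fin 2) ℂ} :
    IsJUnitary Jb (ofMatrix b M) ↔ IsJUnitaryMatrix M := by
  have hform : ∀ x y : G, inner ℂ (ofMatrix b M y) (Jb (ofMatrix b M x)) =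
      conj (M 0 0 * inner ℂ (b 0) y + M 0 1 * inner ℂ (b 1) y) *
        (M 0 0 * inner ℂ (b 0) x + M 0 1 * inner ℂ (b 1) x) -
      conj (M 1 0 * inner ℂ (b 0) y + M 1 1 * inner ℂ (b 1) y) *
        (M 1 0 * inner ℂ (b 0) x + M 1 1 * inner ℂ (b 1) x) := fun x y => by
    rw [inner_eq_coord b, hb.inner_zero_P, hb.inner_one_P, inner_ofMatrix, inner_ofMatrix,
      inner_ofMatrix, inner_ofMatrix]
    ring
  have hJ : ∀ x y : G, inner ℂ y (Jb x) = conj (inner ℂ (b 0) y) * inner ℂ (b 0) x -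
      conj (inner ℂ (b 1) y) * inner ℂ (b 1) x := fun x y => by
    rw [inner_eq_coord b, hb.inner_zero_P, hb.inner_one_P]
    ring
  constructor
  · rintro ⟨-, h⟩
    simp only [hform, hJ] at h
    obtain ⟨e00, e11, e01, e10⟩ := inner_basis_zero_one b
    have h00 := h (b 0) (b 0)
    have h11 := h (b 1) (b 1)
    have h01 := h (b 1) (b 0)
    simp only [e00, e11, e01, e10, mul_one, mul_zero, add_zero, zero_add, map_one, map_zero,
      sub_zero, zero_sub] at h00 h11 h01
    exact ⟨h00, by linear_combination -h11, by linear_combination h01⟩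
  · rintro ⟨h0, h1, h2⟩
    have h2' : M 0 0 * conj (M 0 1) = M 1 0 * conj (M 1 1) := by
      simpa using congrArg conj h2
    have hK : ∀ x y : G, inner ℂ (ofMatrix b M y) (Jb (ofMatrix b M x)) = inner ℂ y (Jb x) := by
      intro x y
      rw [hform, hJ]
      simp only [map_add, map_mul]
      linear_combination conj (inner ℂ (b 0) y) * inner ℂ (b 0) x * h0 -
        conj (inner ℂ (b 1) y) * inner ℂ (b 1) x * h1 +
        conj (inner ℂ (b 0) y) * inner ℂ (b 1) x * h2 +
        conj (inner ℂ (b 1) y) * inner ℂ (b 0) x * h2'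
    have : FiniteDimensional ℂ G := b.toBasis.finiteDimensional_of_finite
    -- Preserving a nondegenerate form gives injectivity, hence surjectivity in finite dimension.
    exact ⟨LinearMap.surjective_of_injective (IsJUnitary.injective hb hK), hK⟩

theorem IsPauliPair.coe_cChiOmega (hb : IsPauliPair b Jb Rb) (χ ω : ℝ) :
    (cChiOmega Jb Rb χ ω : G →ₗ[ℂ] G) = ofMatrix b (cMatrix χ ω) := by
  have e1 : exp (I * ω) = Real.cos ω + I * Real.sin ω := by
    rw [mul_comm, exp_mul_I, ofReal_cos, ofReal_sin]
    ring
  have e2 : exp (-(I * ω)) = Real.cos ω - I * Real.sin ω := by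
    rw [mul_comm, ← neg_mul, exp_mul_I, cos_neg, sin_neg, ofReal_cos, ofReal_sin]
    ring
  refine b.toBasis.ext fun j => ?_
  rw [b.coe_toBasis, ofMatrix_apply_basis, ContinuousLinearMap.coe_coe]
  fin_cases j
  · simp only [cChiOmega, rOmega, cMatrix, ContinuousLinearMap.comp_apply, add_apply, smul_apply,
      ContinuousLinearMap.id_apply, map_add, map_smul, hb.P_zero, hb.Q_zero, hb.P_one, e1,
      Fin.zero_eta, Matrix.of_apply, Matrix.cons_val', Matrix.cons_val_zero,
      Matrix.cons_val_one, Matrix.cons_val_fin_one]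
    module
  · simp only [cChiOmega, rOmega, cMatrix, ContinuousLinearMap.comp_apply, add_apply, smul_apply,
      ContinuousLinearMap.id_apply, map_add, map_smul, map_neg, hb.P_zero, hb.Q_one, hb.P_one, e2,
      Fin.mk_one, Matrix.of_apply, Matrix.cons_val', Matrix.cons_val_zero,
      Matrix.cons_val_one, Matrix.cons_val_fin_one]
    module

/-- J-unitarity means K*𝒥K = 𝒥, so the adjoint condition Ω₊f = K*Ω₋f is inverted by (K*)⁻¹ = 𝒥K𝒥. -/
theorem adjoint_extensionOf (hb : IsPauliPair b Jb Rb) (hS : IsClosedSymmetric S)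
    (hΓ : IsBoundaryTriplet S Γ₀ Γ₁) {K : G →ₗ[ℂ] G} (hK : IsJUnitary Jb K) :
    (extensionOf S Γ₀ Γ₁ K).adjoint =
      extensionOf S Γ₀ Γ₁ ((Jb : G →ₗ[ℂ] G) ∘ₗ K ∘ₗ (Jb : G →ₗ[ℂ] G)) := by
  refine eq_of_le_adjoint (adjoint_le_adjoint hS.1 (le_extensionOf hS hΓ K))
    (extensionOf_le _) fun f => ?_
  rw [mem_graph_adjoint_extensionOf hS hΓ, mem_graph_extensionOf]
  have hK' : ∀ u v, inner ℂ (K u) (((Jb : G →ₗ[ℂ] G) ∘ₗ K ∘ₗ (Jb : G →ₗ[ℂ] G)) v) =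
      inner ℂ u v := fun u v => by
    rw [LinearMap.comp_apply, LinearMap.comp_apply, ContinuousLinearMap.coe_coe, hK.2, hb.P_P]
  constructor
  · intro h
    refine ext_inner_left ℂ fun w => ?_
    obtain ⟨u, rfl⟩ := hK.1 w
    rw [hK', h]
  · intro h u
    rw [← h, hK']

/-- The matrix form of the `C`-symmetries of the boundary space. -/
theorem abs_tanh_lt_of_commute (hb : IsPauliPair b Jb Rb) {ζ φ ξ ω : ℝ}
    (hφ : φ ∈ Set.Icc (0 : ℝ) Real.pi) {C₀ : G →ₗ[ℂ] G} (hCC : ∀ x, C₀ (C₀ x) = x)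
    (hself : ∀ x y, inner ℂ (Jb (C₀ x)) y = inner ℂ x (Jb (C₀ y)))
    (hpos : ∀ x, x ≠ 0 → 0 < (inner ℂ (Jb (C₀ x)) x).re)
    (hcomm : ofMatrix b (kMatrix ζ φ ξ ω) ∘ₗ C₀ = C₀ ∘ₗ ofMatrix b (kMatrix ζ φ ξ ω)) :
    |Real.tanh ζ| < |Real.cos φ| ∨ (ζ = 0 ∧ φ = Real.pi / 2) := by
  obtain ⟨M, rfl⟩ := exists_eq_ofMatrix b C₀
  obtain ⟨e00, e11, e01, e10⟩ := inner_basis_zero_one b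
  have hp0 := hpos (b 0) (b.orthonormal.ne_zero 0)
  have hp1 := hpos (b 1) (b.orthonormal.ne_zero 1)
  have h00 := hself (b 0) (b 0)
  have h11 := hself (b 1) (b 1)
  have h10 := hself (b 0) (b 1)
  rw [← inner_conj_symm] at hp0 hp1 h00 h11 h10
  simp only [hb.inner_zero_P, hb.inner_one_P, inner_ofMatrix, e00, e11, e01, e10, mul_one,
    mul_zero, add_zero, zero_add, map_neg, neg_re, conj_re] at hp0 hp1 h00 h11 h10
  refine abs_tanh_lt_of_boundary_cSymmetry hφ ((ofMatrix_comm_iff b).1 hcomm)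
    (ofMatrix_injective b ?_) h00 (neg_injective h11) ?_ hp0 (by linarith)
  · rw [ofMatrix_mul, ofMatrix_one]
    exact LinearMap.ext hCC
  · rw [← h10, map_neg, conj_conj, neg_neg]

end

/-! ### `C`-symmetries of the extensions -/

section

variable {b : OrthonormalBasis (Fin 2) ℂ G} {Jb Rb : G →L[ℂ] G} {J R : H →L[ℂ] H}

theorem graphInvariant_cChiOmega_iff (hb : IsPauliPair b Jb Rb) (hΓ : IsBoundaryTriplet S Γ₀ Γ₁)
    (hJS : GraphInvariant S.adjoint J) (hRS : GraphInvariant S.adjoint R)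
    (hJ₀ : Intertwines Γ₀ J Jb) (hJ₁ : Intertwines Γ₁ J Jb)
    (hR₀ : Intertwines Γ₀ R Rb) (hR₁ : Intertwines Γ₁ R Rb)
    (M : Matrix (Fin 2) (Fin 2) ℂ) (χ ω : ℝ) :
    GraphInvariant (extensionOf S Γ₀ Γ₁ (ofMatrix b M)) (cChiOmega J R χ ω) ↔
      M * cMatrix χ ω = cMatrix χ ω * M := by
  rw [← ofMatrix_comm_iff b, ← hb.coe_cChiOmega]
  exact graphInvariant_extensionOf_iff hΓ (hC := hJS.cChiOmega hRS χ ω)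
    ((hJ₀.cChiOmega hR₀ χ ω).apply_domainMap _) ((hJ₁.cChiOmega hR₁ χ ω).apply_domainMap _)

/-- Self-adjointness of JC gives (JCJ)* = C. Since JCJ leaves the graph of `S` invariant, its
adjoint C does so for S*. -/
theorem graphInvariant_adjoint_of_mem_cSymmetries (hS : IsClosedSymmetric S)
    (hJ : IsFundamentalSymmetry J) (hSJ : GraphInvariant S J) {C : H →L[ℂ] H}
    (hC : C ∈ cSymmetries J S) : GraphInvariant S.adjoint C := by
  have hSC := (commutes_iff_graphInvariant hC.1).1 hC.2.2
  refine ((hSJ.comp hSC).comp hSJ).adjoint hS.1 fun x y => ?_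
  have h := ContinuousLinearMap.adjoint_inner_right (J ∘L C) (J x) y
  rw [← ContinuousLinearMap.star_eq_adjoint, hC.2.1.1.star_eq] at h
  rw [ContinuousLinearMap.comp_apply, ← h, hJ.inner_left, ContinuousLinearMap.comp_apply,
    apply_apply_of_comp_self hJ.2]

variable (hb : IsPauliPair b Jb Rb) (hS : IsClosedSymmetric S)
  (hΓ : IsBoundaryTriplet S Γ₀ Γ₁) (hd : Module.finrank ℂ (defectSubspace S I) = 2)
  (hJ : IsFundamentalSymmetry J) (hR : IsFundamentalSymmetry R) (hJR : J ∘L R + R ∘L J = 0)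
  (hSJ : GraphInvariant S J) (hSR : GraphInvariant S R)
  (hJ₀ : Intertwines Γ₀ J Jb) (hJ₁ : Intertwines Γ₁ J Jb)
  (hR₀ : Intertwines Γ₀ R Rb) (hR₁ : Intertwines Γ₁ R Rb)
  (hΥ : (upsilon J S).Nonempty) {ζ φ ξ ω : ℝ} (hφ : φ ∈ Set.Icc (0 : ℝ) Real.pi)
  (hmem : extensionOf S Γ₀ Γ₁ (ofMatrix b (kMatrix ζ φ ξ ω)) ∈ sigmaJ J S)
include hb hS hΓ hJ hR hJR hSJ hSR hJ₀ hJ₁ hR₀ hR₁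

theorem hasCSymmetry_extensionOf {χ : ℝ} (h : Real.cos φ * Real.tanh χ = -Real.tanh ζ) :
    HasCSymmetry J (extensionOf S Γ₀ Γ₁ (ofMatrix b (kMatrix ζ φ ξ ω)))
      (cChiOmega J R χ ω) := by
  rw [hasCSymmetry_cChiOmega_iff hJ hR hJR, graphInvariant_cChiOmega_iff hb hΓ
    (hSJ.adjoint hS.1 hJ.inner_left) (hSR.adjoint hS.1 hR.inner_left) hJ₀ hJ₁ hR₀ hR₁]
  exact kMatrix_mul_cMatrix ξ ω h

include hd hΥ hφ hmem

theorem extensionOf_mem_upsilon_iff :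
    extensionOf S Γ₀ Γ₁ (ofMatrix b (kMatrix ζ φ ξ ω)) ∈ upsilon J S ↔
      ζ = 0 ∧ φ = Real.pi / 2 := by
  constructor
  · intro h
    have hC : ∀ χ, kMatrix ζ φ ξ ω * cMatrix χ 0 = cMatrix χ 0 * kMatrix ζ φ ξ ω := fun χ => by
      rw [← graphInvariant_cChiOmega_iff hb hΓ (hSJ.adjoint hS.1 hJ.inner_left)
        (hSR.adjoint hS.1 hR.inner_left) hJ₀ hJ₁ hR₀ hR₁,
        ← commutes_iff_graphInvariant (cChiOmega_comp_self hJ hR hJR χ 0)]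
      exact h.2 _ (cChiOmega_mem_cSymmetries hJ hR hJR hSJ hSR χ 0)
    -- The case χ = 0 is commutation with J and kills sinh ζ; the case χ = 1 then kills cos φ.
    have h0 := cos_mul_eq_of_commute (hC 0)
    have h1 := cos_mul_eq_of_commute (hC 1)
    have hζ : ζ = 0 := by
      rw [← Real.sinh_eq_zero]
      simpa [cMatrix, ← ofReal_sinh, -ofReal_sinh, exp_ne_zero] using h0
    refine ⟨hζ, eq_pi_div_two_of_cos_eq_zero hφ ?_⟩
    have hs : Real.sinh 1 ≠ 0 := (Real.sinh_pos_iff.2 one_pos).ne'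
    rw [hζ] at h1
    simp only [cMatrix, Matrix.of_apply, Matrix.cons_val', Matrix.cons_val_zero,
      Matrix.cons_val_one, Matrix.cons_val_fin_one, Real.sinh_zero, Real.cosh_zero, ofReal_zero,
      ofReal_one, mul_zero, neg_zero, exp_zero, one_mul, mul_one, neg_eq_zero, mul_eq_zero,
      ofReal_eq_zero, hs, or_false, OfNat.ofNat_ne_zero, false_or] at h1
    exact h1
  · rintro ⟨rfl, rfl⟩
    refine ⟨hmem, fun C hC => ?_⟩
    have hCS := graphInvariant_adjoint_of_mem_cSymmetries hS hJ hSJ hC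
    obtain ⟨C₀, -, -, -, h₀, h₁⟩ := exists_boundary_cSymmetry_of_upsilon hb hS hΓ hd hJ hR hJR hSJ
      hSR hJ₀ hJ₁ hR₀ hR₁ hΥ hC hCS
    rw [commutes_iff_graphInvariant hC.1, graphInvariant_extensionOf_iff hΓ h₀ h₁]
    -- At these parameters K is scalar, so it commutes with whatever C₀ a C-symmetry induces.
    have hK : ofMatrix b (kMatrix 0 (Real.pi / 2) ξ ω) = (I * exp (-(I * ξ))) • LinearMap.id := by
      rw [kMatrix_zero_pi_div_two, ← ofMatrix_one b, ofMatrix, ofMatrix, ← map_smul]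
      congr 1
      ext i j
      fin_cases i <;> fin_cases j <;> simp
    rw [hK, LinearMap.smul_comp, LinearMap.comp_smul, LinearMap.id_comp, LinearMap.comp_id]

theorem extensionOf_mem_sigmaJst_diff_iff :
    extensionOf S Γ₀ Γ₁ (ofMatrix b (kMatrix ζ φ ξ ω)) ∈ sigmaJst J S \ upsilon J S ↔
      |Real.tanh ζ| < |Real.cos φ| := by
  have hiff := extensionOf_mem_upsilon_iff hb hS hΓ hd hJ hR hJR hSJ hSR hJ₀ hJ₁ hR₀ hR₁ hΥ hφ hmem
  rw [Set.mem_sdiff, hiff]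
  constructor
  · rintro ⟨⟨-, C, hC, hAC⟩, hne⟩
    have hCS := graphInvariant_adjoint_of_mem_cSymmetries hS hJ hSJ hC
    obtain ⟨C₀, h1, h2, h3, h₀, h₁⟩ := exists_boundary_cSymmetry_of_upsilon hb hS hΓ hd hJ hR hJR
      hSJ hSR hJ₀ hJ₁ hR₀ hR₁ hΥ hC hCS
    have hcomm := (graphInvariant_extensionOf_iff hΓ h₀ h₁).1
      ((commutes_iff_graphInvariant hC.1).1 hAC.2.2)
    exact (abs_tanh_lt_of_commute hb hφ h1 h2 h3 hcomm).resolve_right hne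
  · intro h
    obtain ⟨χ, hχ, -⟩ := existsUnique_tanh h
    refine ⟨⟨hmem, _, cChiOmega_mem_cSymmetries hJ hR hJR hSJ hSR χ ω,
      hasCSymmetry_extensionOf hb hS hΓ hJ hR hJR hSJ hSR hJ₀ hJ₁ hR₀ hR₁ hχ⟩, ?_⟩
    rintro ⟨rfl, rfl⟩
    simp at h

end

end

end KreinExt

end

/-! ### Assembly of the theorem -/

theorem theorem4p3
    {H : Type*} [NormedAddCommGroup H] [InnerProductSpace ℂ H] [CompleteSpace H]
    {G : Type*} [NormedAddCommGroup G] [InnerProductSpace ℂ G] [CompleteSpace G]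
    (J R : H →L[ℂ] H)
    (hJ : IsFundamentalSymmetry J) (hR : IsFundamentalSymmetry R)
    (hJR : J ∘L R + R ∘L J = 0)
    (S : H →ₗ.[ℂ] H)
    (hS : IsClosedSymmetric S) (hsimple : IsSimple S) (hdefect : HasDefectTwoTwo S)
    (hSJ : Commutes S J) (hSR : Commutes S R)
    (hUpsilon : (upsilon J S).Nonempty)
    (Γ₀ Γ₁ : S.adjoint.domain →ₗ[ℂ] G)
    (hΓ : IsBoundaryTriplet S Γ₀ Γ₁)
    (Jb Rb : G →L[ℂ] G)
    (hJb₀ : Intertwines Γ₀ J Jb) (hJb₁ : Intertwines Γ₁ J Jb)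
    (hRb₀ : Intertwines Γ₀ R Rb) (hRb₁ : Intertwines Γ₁ R Rb)
    (b : OrthonormalBasis (Fin 2) ℂ G)
    (hbJ : (Jb : G →ₗ[ℂ] G) = ofMatrix b !![1, 0; 0, -1])
    (hbR : (Rb : G →ₗ[ℂ] G) = ofMatrix b !![0, 1; 1, 0]) :
    -- the extensions `A_K` in `Σ_J` and their parametrization
    (∀ K : G →ₗ[ℂ] G,
      (extensionOf S Γ₀ Γ₁ K ∈ sigmaJ J S ↔ IsJUnitary Jb K) ∧
      (IsJUnitary Jb K ↔
        ∃ ζ : ℝ, ∃ φ ∈ Set.Icc (0 : ℝ) Real.pi, ∃ ξ ∈ Set.Ico (0 : ℝ) (2 * Real.pi),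
          ∃ ω ∈ Set.Ico (0 : ℝ) (2 * Real.pi), K = ofMatrix b (kMatrix ζ φ ξ ω))) ∧
    (∀ ζ : ℝ, ∀ φ ∈ Set.Icc (0 : ℝ) Real.pi, ∀ ξ ∈ Set.Ico (0 : ℝ) (2 * Real.pi),
      ∀ ω ∈ Set.Ico (0 : ℝ) (2 * Real.pi),
      -- the adjoint
      ((extensionOf S Γ₀ Γ₁ (ofMatrix b (kMatrix ζ φ ξ ω))).adjoint ∈ sigmaJ J S ∧
        (extensionOf S Γ₀ Γ₁ (ofMatrix b (kMatrix ζ φ ξ ω))).adjoint =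
          extensionOf S Γ₀ Γ₁ (ofMatrix b (kMatrix (-ζ) φ ξ ω))) ∧
      -- self-adjointness
      ((IsSelfAdjoint (extensionOf S Γ₀ Γ₁ (ofMatrix b (kMatrix ζ φ ξ ω))) ↔ ζ = 0) ∧
        kMatrix 0 φ ξ ω =
          Complex.exp (-(Complex.I * ξ)) •
            !![-Complex.exp (-(Complex.I * φ)), 0; 0, Complex.exp (Complex.I * φ)]) ∧
      -- stable `C`-symmetry
      (extensionOf S Γ₀ Γ₁ (ofMatrix b (kMatrix ζ φ ξ ω)) ∈ sigmaJst J S \ upsilon J S ↔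
        |Real.tanh ζ| < |Real.cos φ|) ∧
      -- the set `Υ`
      ((extensionOf S Γ₀ Γ₁ (ofMatrix b (kMatrix ζ φ ξ ω)) ∈ upsilon J S ↔
        ζ = 0 ∧ φ = Real.pi / 2) ∧
        kMatrix 0 (Real.pi / 2) ξ ω =
          !![Complex.I * Complex.exp (-(Complex.I * ξ)), 0;
             0, Complex.I * Complex.exp (-(Complex.I * ξ))]) ∧
      -- the `C`-symmetry in the stable case
      (|Real.tanh ζ| < |Real.cos φ| →
        (∃! χ : ℝ, Real.cos φ * Real.tanh χ = -Real.tanh ζ) ∧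
        ∀ χ : ℝ, Real.cos φ * Real.tanh χ = -Real.tanh ζ →
          HasCSymmetry J (extensionOf S Γ₀ Γ₁ (ofMatrix b (kMatrix ζ φ ξ ω)))
            (cChiOmega J R χ ω))) := by
  have hb := isPauliPair_of_matrix b hbJ hbR
  have : FiniteDimensional ℂ G := b.toBasis.finiteDimensional_of_finite
  have hSJ' := (commutes_iff_graphInvariant hJ.2).1 hSJ
  have hSR' := (commutes_iff_graphInvariant hR.2).1 hSR
  have hsigma : ∀ K : G →ₗ[ℂ] G, extensionOf S Γ₀ Γ₁ K ∈ sigmaJ J S ↔ IsJUnitary Jb K := fun K =>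
    extensionOf_mem_sigmaJ_iff hS hΓ hJ.2 hb.P_P (hSJ'.adjoint hS.1 hJ.inner_left) hJb₀ hJb₁
  have hunit : ∀ ζ φ ξ ω : ℝ, IsJUnitary Jb (ofMatrix b (kMatrix ζ φ ξ ω)) := fun ζ φ ξ ω =>
    (isJUnitary_ofMatrix_iff hb).2 (isJUnitaryMatrix_kMatrix ζ φ ξ ω)
  have hadj : ∀ ζ φ ξ ω : ℝ, (extensionOf S Γ₀ Γ₁ (ofMatrix b (kMatrix ζ φ ξ ω))).adjoint =
      extensionOf S Γ₀ Γ₁ (ofMatrix b (kMatrix (-ζ) φ ξ ω)) := fun ζ φ ξ ω => by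
    rw [adjoint_extensionOf hb hS hΓ (hunit ζ φ ξ ω), hbJ, ← ofMatrix_mul, ← ofMatrix_mul,
      kMatrix_neg, mul_assoc]
  refine ⟨fun K => ⟨hsigma K, fun hK => ?_, ?_⟩, fun ζ φ hφ ξ hξ ω hω => ⟨⟨?_, hadj ζ φ ξ ω⟩,
    ⟨⟨fun h => ?_, ?_⟩, kMatrix_zero φ ξ ω⟩, ?_, ⟨?_, kMatrix_zero_pi_div_two ξ ω⟩,
    fun h => ⟨existsUnique_tanh h, fun χ hχ => ?_⟩⟩⟩
  · obtain ⟨M, rfl⟩ := exists_eq_ofMatrix b K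
    obtain ⟨ζ, φ, hφ, ξ, hξ, ω, hω, rfl⟩ :=
      ((isJUnitary_ofMatrix_iff hb).1 hK).exists_eq_kMatrix
    exact ⟨ζ, φ, hφ, ξ, hξ, ω, hω, rfl⟩
  · rintro ⟨ζ, φ, -, ξ, -, ω, -, rfl⟩
    exact hunit ζ φ ξ ω
  · rw [hadj, hsigma]
    exact hunit _ _ _ _
  · rw [LinearPMap.isSelfAdjoint_def, hadj] at h
    -- K is determined by A_K, and K(-ζ), K(ζ) differ only in the off-diagonal sign; the (0, 1)
    -- entry gives sinh(-ζ) = sinh ζ.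
    have h1 := congrFun (congrFun (ofMatrix_injective b (extensionOf_injective hΓ h)) 0) 1
    rw [← Real.sinh_eq_zero]
    have h2 : (Real.sinh (-ζ) : ℂ) = Real.sinh ζ := by
      simpa [kMatrix, Complex.exp_ne_zero, -Complex.ofReal_sinh, -Real.sinh_neg,
        -Complex.ofReal_neg] using h1
    have h3 : Real.sinh (-ζ) = Real.sinh ζ := by exact_mod_cast h2
    rw [Real.sinh_neg] at h3
    linarith
  · rintro rfl
    rw [LinearPMap.isSelfAdjoint_def, hadj, neg_zero]
  · exact extensionOf_mem_sigmaJst_diff_iff hb hS hΓ hdefect.1 hJ hR hJR hSJ' hSR' hJb₀ hJb₁ hRb₀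
      hRb₁ hUpsilon hφ ((hsigma _).2 (hunit _ _ _ _))
  · exact extensionOf_mem_upsilon_iff hb hS hΓ hdefect.1 hJ hR hJR hSJ' hSR' hJb₀ hJb₁ hRb₀
      hRb₁ hUpsilon hφ ((hsigma _).2 (hunit _ _ _ _))
  · exact hasCSymmetry_extensionOf hb hS hΓ hJ hR hJR hSJ' hSR' hJb₀ hJb₁ hRb₀ hRb₁ hχ
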